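/- Let $(W_j)_{j\ge1}$ and $(Z_j)_{j\ge1}$ be two sequences of i.i.d. real random variables on a probability space $(\Omega,\mathcal F,\mathbb P)$, independent of each other; let $\mathcal W=\sigma(W_j,\,j\ge1)$ and $S_n=\sum_{j=1}^n W_jZ_j$. Fix $\vartheta_*>0$ and assume the following. (i) $Z_1$ is not concentrated on one point; (a) if $Z_1$ is lattice valued (there are $b\in\mathbb R$, $h>0$ with $Z_1\in b+h\mathbb Z$ a.s.), then there are $c<d$ and $p>0$ such that the density of the absolutely continuous part of the law of $W_1$ is at least $p$ almost everywhere on $[c,d]$; (b) if $Z_1$ has a density, then $\mathbb P(|W_1|>0)>0$. (ii) $M(\vartheta)=\mathbb E[e^{\vartheta Z_1}]$ is finite for all $\vartheta\in\mathbb R$. (iii) With $f=\log M$, the random variables $f(\vartheta W_1)$ and $W_1f'(\vartheta W_1)$ are integrable for all $\vartheta\in\mathbb R$. (iv) There is $F:\mathbb R\to\mathbb R$ with $\mathbb E[F(W_1)]<\infty$ and, for every $\vartheta\in[0,\vartheta_*]$, $W_1^2f''(\vartheta W_1)\le F(W_1)$ almost surely. Put $\Psi_n^{\mathcal W}(\vartheta)=\frac1n\sum_{j=1}^n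 f(W_j\vartheta)$ and $J=\bigl(\mathbb E[W_1]\mathbb E[Z_1],\ \mathbb E[W_1f'(\vartheta_*W_1)]\bigr)$, and let $\mathbb P(S_n\in\cdot\,|\,\mathcal W)$ be a regular conditional distribution of $S_n$ given $\mathcal W$. Then, almost surely, the following holds simultaneously for all $a\in J$: for all sufficiently large $n$ the equation $\frac{d}{d\vartheta}\Psi_n^{\mathcal W}(\vartheta)=a$ has a unique solution $\vartheta_n^{\mathcal W}(a)\in\mathbb R$, it is positive, $\sigma_n^{\mathcal W}(a):=\sqrt{(\Psi_n^{\mathcal W})''(\vartheta_n^{\mathcal W}(a))}>0$, and, as $n\to\infty$, $$\mathbb P(S_n\ge an\,|\,\mathcal W)=\frac{\exp\bigl(-nI_n^{\mathcal W}(a)\bigr)}{\sqrt{2\pi n}\;\vartheta_n^{\mathcal W}(a)\,\sigma_n^{\mathcal W}(a)}\,(1+o(1)),\qquad I_n^{\mathcal W}(a)=a\,\vartheta_n^{\mathcal W}(a)-\Psi_n^{\mathcal W}\bigl(\vartheta_n^{\mathcal W}(a)\bigr).$$ -/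

import Mathlib

open MeasureTheory ProbabilityTheory Filter Asymptotics

noncomputable section

namespace CondLD

variable {Ω : Type*} [MeasurableSpace Ω]

/-- The weighted sum `S_n = ∑ W_j Z_j` of the first `n` terms (the sequences are indexed from `0`,
so `W 0`, `Z 0` play the role of `W_1`, `Z_1`). -/
def weightedSum (W Z : ℕ → Ω → ℝ) (n : ℕ) (ω : Ω) : ℝ :=
  ∑ j ∈ Finset.range n, W j ω * Z j ω

/-- The conditional probability `P(S_n ≥ a n | 𝒲)(ω)`, `𝒲 = σ(W_j, j ∈ ℕ)`, taken from the regular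
conditional distribution of `S_n` given the whole sequence `(W_j)_j`, so that one null set serves
all `a`. -/
def condTail (μ : Measure Ω) [IsProbabilityMeasure μ] (W Z : ℕ → Ω → ℝ) (n : ℕ) (a : ℝ) (ω : Ω) :
    ℝ :=
  (condDistrib (weightedSum W Z n) (fun ω' j => W j ω') μ (fun j => W j ω)).real
    (Set.Ici (a * n))

/-- A real random variable is lattice valued if it a.s. takes values in some `b + h ℤ`, `h > 0`. -/
def LatticeValued (μ : Measure Ω) (X : Ω → ℝ) : Prop :=
  ∃ b h : ℝ, 0 < h ∧ ∀ᵐ ω ∂μ, ∃ k : ℤ, X ω = b + k * h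

/-- The absolutely continuous part of the law of `X` has, on some nondegenerate interval `[c, d]`,
a density bounded below by some `p > 0`. -/
def DensityBoundedBelow (μ : Measure Ω) (X : Ω → ℝ) : Prop :=
  ∃ c d p : ℝ, c < d ∧ 0 < p ∧
    ∀ᵐ x ∂(volume : Measure ℝ), x ∈ Set.Icc c d →
      ENNReal.ofReal p ≤ (μ.map X).rnDeriv volume x

/-- `Ψ_n(ϑ) = (1/n) ∑_{j<n} f(w_j ϑ)`, for a realisation `w` of the weights. -/
def Psi (f : ℝ → ℝ) (w : ℕ → ℝ) (n : ℕ) (ϑ : ℝ) : ℝ :=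
  (1 / (n : ℝ)) * ∑ j ∈ Finset.range n, f (w j * ϑ)

/-- The rate `a ϑ - (1/n) ∑_{j<n} f(w_j ϑ)`, to be evaluated at the solution `ϑ` of
`Ψ_n'(ϑ) = a`. -/
def rate (f : ℝ → ℝ) (w : ℕ → ℝ) (n : ℕ) (a ϑ : ℝ) : ℝ :=
  a * ϑ - Psi f w n ϑ

/-- `σ_n = √(Ψ_n''(ϑ))`, to be evaluated at the solution `ϑ` of `Ψ_n'(ϑ) = a`. -/
def sigma (f : ℝ → ℝ) (w : ℕ → ℝ) (n : ℕ) (ϑ : ℝ) : ℝ :=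
  √(iteratedDeriv 2 (Psi f w n) ϑ)

end CondLD

end

noncomputable section

namespace CondLD

open Topology Complex

/-! Freeze the weights `w` and tilt by `e^{θ S_n}`, with `θ` the saddle point, so that `S_n - a n`
becomes centred. On `{S_n ≥ a n}` the change of measure (`real_Ici_map_detSum`) turns the tail into
`e^{-n I_n} θ⁻¹ ∫_{x ≥ 0} θ e^{-θ x} Q_n(dx)`, where `Q_n` is the tilted law of `S_n - a n` and the
integral is `expTail`. As `θ e^{-θ x}` has total mass one, the claim is a local limit theorem: on
bounded scales `Q_n` behaves like Lebesgue measure divided by `√(2π Var)`.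

`Q_n` need not have a density, so `expTail` is smoothed by a kernel whose Fourier transform has
compact support. The smoothed quantity depends only on the characteristic function of `Q_n` on a
bounded interval (`integral_expTail_mul_kernel`), and the smoothing is undone by a one-sided
Tauberian argument (`tendsto_expTail_of_smoothedTail`), since `u ↦ e^{-θ u} expTail u` is
nonincreasing.

The characteristic function is a product of tilted factors evaluated at `w_j t`. At scale `1/√Var` a
Lindeberg argument gives the Gaussian limit (`RegularWeights.tendsto_prod_tiltedCharFun`). On a
fixed compact set it is at most `e^{-c n t²}` (`RegularWeights.exists_norm_prod_le`): near each `t₀`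
a positive proportion of the factors has modulus bounded away from one, or, at `t₀ = 0`, is
Gaussian-bounded.

What is needed of the weights is collected in `RegularWeights`, which does not involve `a` and holds
almost surely by the strong law (`ae_regularWeights`); hence one null set serves all `a`. If `Z` is
lattice, the frequencies at which it is arithmetic form a countable set, which weights spread over
an interval avoid; if not, any nonzero point of the support of `W` will do. Finally `Ψ_n'` is
increasing and converges at `ϑs / (m + 1)` for every `m`, which confines the saddle points to a
compact part of `(0, ϑs]`. -/

/-! ### The Fejér kernel -/

/-- The triangle function on `[-1, 1]`. -/
def triangle (t : ℝ) : ℝ := max (1 - |t|) 0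

lemma continuous_triangle : Continuous triangle := by unfold triangle; fun_prop

lemma triangle_zero : triangle 0 = 1 := by simp [triangle]

lemma triangle_nonneg (t : ℝ) : 0 ≤ triangle t := le_max_right _ _

lemma triangle_le_one (t : ℝ) : triangle t ≤ 1 := by
  unfold triangle; exact max_le (by linarith [abs_nonneg t]) zero_le_one

lemma triangle_eq_zero {t : ℝ} (ht : 1 ≤ |t|) : triangle t = 0 := by
  unfold triangle; exact max_eq_right (by linarith)

lemma integrable_triangle : Integrable (fun t => (triangle t : ℂ)) := by
  apply Continuous.integrable_of_hasCompactSupport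
  · exact continuous_ofReal.comp continuous_triangle
  · refine HasCompactSupport.intro (K := Set.Icc (-1) 1) isCompact_Icc fun x hx => ?_
    rw [triangle_eq_zero, ofReal_zero]
    by_contra! h
    exact hx (by rw [abs_lt] at h; exact ⟨h.1.le, h.2.le⟩)

lemma integral_triangle_mul_cexp {c : ℂ} (hc : c ≠ 0) :
    ∫ t : ℝ, (triangle t : ℂ) * cexp (c * t) = (cexp c + cexp (-c) - 2) / c ^ 2 := by
  have h0 : ∫ t : ℝ, (triangle t : ℂ) * cexp (c * t)
      = ∫ t in (-1 : ℝ)..1, (triangle t : ℂ) * cexp (c * t) := by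
    rw [intervalIntegral.integral_of_le (by norm_num), setIntegral_eq_integral_of_forall_compl_eq_zero]
    intro x hx
    rw [triangle_eq_zero, ofReal_zero, zero_mul]
    by_contra! h
    exact hx (by rw [abs_lt] at h; exact ⟨h.1, h.2.le⟩)
  have hcont : Continuous fun t : ℝ => (triangle t : ℂ) * cexp (c * t) := by
    have := continuous_triangle
    fun_prop
  rw [h0, ← intervalIntegral.integral_add_adjacent_intervals (b := 0)
    (hcont.intervalIntegrable _ _) (hcont.intervalIntegrable _ _)]
  have hexp (t : ℝ) : HasDerivAt (fun t : ℝ => cexp (c * t)) (c * cexp (c * t)) t := by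
    have := ((hasDerivAt_id t).ofReal_comp.const_mul c).cexp
    simpa [mul_comm] using this
  have hid (t : ℝ) : HasDerivAt (fun t : ℝ => (t : ℂ)) 1 t := (hasDerivAt_id t).ofReal_comp
  have h1 : ∫ t in (-1 : ℝ)..0, (triangle t : ℂ) * cexp (c * t)
      = 1 / c - 1 / c ^ 2 + cexp (-c) / c ^ 2 := by
    rw [intervalIntegral.integral_congr (g := fun t : ℝ => (1 + t : ℂ) * cexp (c * t)),
      intervalIntegral.integral_eq_sub_of_hasDerivAt
        (f := fun t : ℝ => ((1 + t) / c - 1 / c ^ 2 : ℂ) * cexp (c * t))]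
    · simp; ring
    · intro t _
      have := ((((hid t).const_add 1).div_const c).sub_const (1 / c ^ 2)).mul (hexp t)
      exact this.congr_deriv (by field_simp; ring)
    · apply Continuous.intervalIntegrable; fun_prop
    · intro t ht
      simp only [Set.uIcc_of_le (show (-1 : ℝ) ≤ 0 by norm_num), Set.mem_Icc] at ht
      simp only [triangle, abs_of_nonpos ht.2]
      rw [max_eq_left (by linarith)]
      push_cast; ring
  have h2 : ∫ t in (0 : ℝ)..1, (triangle t : ℂ) * cexp (c * t)
      = cexp c / c ^ 2 - 1 / c - 1 / c ^ 2 := by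
    rw [intervalIntegral.integral_congr (g := fun t : ℝ => (1 - t : ℂ) * cexp (c * t)),
      intervalIntegral.integral_eq_sub_of_hasDerivAt
        (f := fun t : ℝ => ((1 - t) / c + 1 / c ^ 2 : ℂ) * cexp (c * t))]
    · simp; ring
    · intro t _
      have := ((((hid t).const_sub 1).div_const c).add_const (1 / c ^ 2)).mul (hexp t)
      exact this.congr_deriv (by field_simp; ring)
    · apply Continuous.intervalIntegrable; fun_prop
    · intro t ht
      simp only [Set.uIcc_of_le (show (0 : ℝ) ≤ 1 by norm_num), Set.mem_Icc] at ht
      simp only [triangle, abs_of_nonneg ht.1]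
      rw [max_eq_left (by linarith)]
      push_cast; ring
  rw [h1, h2]; ring

/-- The Fejér kernel, with the normalisation `∫ K = 1`. -/
def fejer (v : ℝ) : ℝ := ((1 / (2 * Real.pi) : ℝ) * ∫ t : ℝ, (triangle t : ℂ) * cexp (-I * v * t)).re

/-- Positivity and quadratic decay come from the closed form, which divides by `v ^ 2`; the bound by
the total mass covers the neighbourhood of `v = 0`. -/
lemma integral_triangle_real (v : ℝ) : ∃ r : ℝ, 0 ≤ r ∧ r ≤ ∫ t : ℝ, triangle t ∧
    (v ≠ 0 → r = (2 - 2 * Real.cos v) / v ^ 2) ∧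
    ∫ t : ℝ, (triangle t : ℂ) * cexp (-I * v * t) = r := by
  have hle : ‖∫ t : ℝ, (triangle t : ℂ) * cexp (-I * v * t)‖ ≤ ∫ t : ℝ, triangle t := by
    refine (norm_integral_le_integral_norm _).trans_eq ?_
    congr 1; ext t
    have : -I * v * t = ((-(v * t) : ℝ) : ℂ) * I := by push_cast; ring
    rw [norm_mul, this, norm_exp_ofReal_mul_I, mul_one, Complex.norm_of_nonneg (triangle_nonneg t)]
  by_cases hv : v = 0
  · subst hv
    refine ⟨∫ t : ℝ, triangle t, integral_nonneg triangle_nonneg, le_rfl, by simp, ?_⟩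
    simp [integral_complex_ofReal]
  · have hr : ∫ t : ℝ, (triangle t : ℂ) * cexp (-I * v * t)
        = ((2 - 2 * Real.cos v) / v ^ 2 : ℝ) := by
      rw [integral_triangle_mul_cexp (by simpa using hv)]
      have : cexp (-I * v) + cexp (-(-I * v)) = 2 * Complex.cos v := by
        rw [Complex.two_cos]; ring_nf
      rw [this]
      push_cast
      rw [mul_pow, neg_sq, I_sq]
      have : (v : ℂ) ≠ 0 := by exact_mod_cast hv
      field_simp
      ring
    have h0 : 0 ≤ (2 - 2 * Real.cos v) / v ^ 2 := by
      have := Real.cos_le_one v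
      apply div_nonneg <;> nlinarith
    refine ⟨_, h0, ?_, fun _ => rfl, hr⟩
    rw [hr, Complex.norm_of_nonneg h0] at hle
    linarith

lemma ofReal_fejer (v : ℝ) :
    (fejer v : ℂ) = (1 / (2 * Real.pi) : ℝ) * ∫ t : ℝ, (triangle t : ℂ) * cexp (-I * v * t) := by
  obtain ⟨r, -, -, -, h⟩ := integral_triangle_real v
  rw [fejer, h, ← ofReal_mul, ofReal_re]

lemma fejer_nonneg (v : ℝ) : 0 ≤ fejer v := by
  obtain ⟨r, h0, -, -, h⟩ := integral_triangle_real v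
  rw [fejer, h, ← ofReal_mul, ofReal_re]
  have := Real.pi_pos
  positivity

lemma fourier_triangle (v : ℝ) : FourierTransform.fourier (fun t => (triangle t : ℂ)) v
    = ((2 * Real.pi) * fejer (2 * Real.pi * v) : ℝ) := by
  rw [Real.fourier_real_eq_integral_exp_smul]
  push_cast
  rw [ofReal_fejer]
  have := Real.pi_ne_zero
  push_cast
  field_simp
  congr 1; ext t
  simp only [smul_eq_mul]
  rw [mul_comm]
  congr 2; ring

lemma integrable_fejer : Integrable fejer := by
  have hmeas : AEStronglyMeasurable fejer := by
    have hc : Continuous (fun v : ℝ => ∫ t : ℝ, (triangle t : ℂ) * cexp (-I * v * t)) := by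
      refine continuous_of_dominated (bound := fun t => triangle t) (fun v => ?_) (fun v => ?_) ?_ ?_
      · have := continuous_triangle
        exact Continuous.aestronglyMeasurable (by fun_prop)
      · refine Eventually.of_forall fun t => ?_
        have : -I * v * t = ((-(v * t) : ℝ) : ℂ) * I := by push_cast; ring
        rw [norm_mul, this, norm_exp_ofReal_mul_I, mul_one,
          Complex.norm_of_nonneg (triangle_nonneg t)]
      · simpa using integrable_triangle.re
      · exact Eventually.of_forall fun t => by fun_prop
    have : Continuous fejer := by unfold fejer; fun_prop
    exact this.aestronglyMeasurable
  set M := ∫ t : ℝ, triangle t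
  have hM : 0 ≤ M := integral_nonneg triangle_nonneg
  -- Adding `r ≤ M` and `r v² = 2 - 2 cos v ≤ 4` gives `r (1 + v²) ≤ M + 4`.
  refine (integrable_inv_one_add_sq.const_mul (M + 4)).mono' hmeas (Eventually.of_forall fun v => ?_)
  obtain ⟨r, h0, h1, h2, h⟩ := integral_triangle_real v
  rw [Real.norm_of_nonneg (fejer_nonneg v), fejer, h, ← ofReal_mul, ofReal_re]
  have hpi : 1 / (2 * Real.pi) ≤ 1 := by
    rw [div_le_one (by positivity)]; linarith [Real.pi_gt_three]
  have hr : r ≤ (M + 4) * (1 + v ^ 2)⁻¹ := by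
    rw [← div_eq_mul_inv, le_div_iff₀ (by positivity)]
    by_cases hv : v = 0
    · subst hv; simp; linarith
    · have : r * v ^ 2 = 2 - 2 * Real.cos v := by rw [h2 hv]; field_simp
      nlinarith [Real.neg_one_le_cos v]
  calc _ ≤ 1 * r := by gcongr
    _ ≤ _ := by linarith

/-- Fourier inversion for the triangle at the point `0`, where its value is `1`. -/
lemma integral_fejer : ∫ v, fejer v = 1 := by
  have hpi := Real.pi_pos
  have hF : FourierTransform.fourier (fun t => (triangle t : ℂ))
      = fun v => (((2 * Real.pi) * fejer (2 * Real.pi * v) : ℝ) : ℂ) := by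
    ext v; exact fourier_triangle v
  have hi : Integrable (fun v => (2 * Real.pi) * fejer (2 * Real.pi * v)) :=
    (integrable_fejer.comp_mul_left' (by positivity)).const_mul _
  have h := Integrable.fourierInv_fourier_eq (f := fun t => (triangle t : ℂ)) (v := 0)
    integrable_triangle (by rw [hF]; exact hi.ofReal)
    (by have := continuous_triangle; fun_prop)
  rw [hF, Real.fourierInv_eq, triangle_zero] at h
  simp only [inner_zero_right, AddChar.map_zero_eq_one, one_smul, integral_complex_ofReal] at h
  rw [integral_const_mul, Measure.integral_comp_mul_left fejer (2 * Real.pi)] at h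
  rw [abs_of_pos (by positivity), smul_eq_mul] at h
  have : ((2 * Real.pi) * ((2 * Real.pi)⁻¹ * ∫ v, fejer v) : ℝ) = 1 := by exact_mod_cast h
  rw [← this]; field_simp

/-- A probability density whose Fourier transform is continuous with compact support. -/
structure IsBandLimited (K : ℝ → ℝ) : Prop where
  nonneg : ∀ v, 0 ≤ K v
  integrable : Integrable K
  integral_eq_one : ∫ v, K v = 1
  exists_transform : ∃ (T : ℝ) (τ : ℝ → ℝ), 0 < T ∧ Continuous τ ∧ τ 0 = 1 ∧ (∀ t, |τ t| ≤ 1) ∧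
    (∀ t, T < |t| → τ t = 0) ∧
    ∀ v : ℝ, (K v : ℂ) = (1 / (2 * Real.pi) : ℝ) * ∫ t : ℝ, (τ t : ℂ) * cexp (-I * v * t)

lemma isBandLimited_scaled_fejer {T : ℝ} (hT : 0 < T) :
    IsBandLimited fun v => T * fejer (T * v) where
  nonneg v := mul_nonneg hT.le (fejer_nonneg _)
  integrable := (integrable_fejer.comp_mul_left' hT.ne').const_mul _
  integral_eq_one := by
    rw [integral_const_mul, Measure.integral_comp_mul_left fejer T, integral_fejer,
      abs_of_pos (by positivity)]
    simp [hT.ne']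
  exists_transform := by
    refine ⟨T, fun t => triangle (t / T), hT, continuous_triangle.comp (by fun_prop),
      by simp [triangle_zero], fun t => ?_, fun t ht => ?_, fun v => ?_⟩
    · rw [abs_of_nonneg (triangle_nonneg _)]; exact triangle_le_one _
    · apply triangle_eq_zero
      rw [abs_div, abs_of_pos hT, le_div_iff₀ hT]; linarith
    · have := Measure.integral_comp_mul_left
        (fun t : ℝ => (triangle t : ℂ) * cexp (-I * (T * v : ℝ) * t)) T⁻¹
      rw [ofReal_mul, ofReal_fejer]
      simp only [inv_inv, abs_of_pos hT] at this
      have hT' : (T : ℂ) ≠ 0 := by exact_mod_cast hT.ne'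
      have h2 : ∀ t : ℝ, cexp (-I * v * t) = cexp (-I * (T * v : ℝ) * (T⁻¹ * t : ℝ)) := by
        intro t; congr 1; push_cast; field_simp
      simp_rw [h2, div_eq_inv_mul, this, real_smul]
      push_cast; ring

/-- If `[-R, R]` carries mass `1 - ε` of the Fejér kernel, then compressing by `R / ε` moves that
mass into `[-ε, ε]`. Dilation keeps the transform compactly supported. -/
lemma exists_isBandLimited_concentrated {ε : ℝ} (hε : 0 < ε) :
    ∃ K, IsBandLimited K ∧ 1 - ε ≤ ∫ v in Set.Icc (-ε) ε, K v := by
  have h := intervalIntegral_tendsto_integral (f := fejer) (μ := volume) (l := atTop) (a := fun R => -R)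
    (b := fun R => R) integrable_fejer tendsto_neg_atTop_atBot tendsto_id
  rw [integral_fejer] at h
  obtain ⟨R, hR, hR0⟩ := ((h.eventually (lt_mem_nhds (show 1 - ε < 1 by linarith))).and
    (eventually_gt_atTop 0)).exists
  refine ⟨_, isBandLimited_scaled_fejer (T := R / ε) (by positivity), ?_⟩
  rw [integral_Icc_eq_integral_Ioc, ← intervalIntegral.integral_of_le (by linarith),
    intervalIntegral.integral_const_mul, intervalIntegral.integral_comp_mul_left fejer (by positivity)]
  have : R / ε * ε = R := by field_simp
  rw [mul_neg, this, smul_eq_mul, ← mul_assoc, mul_inv_cancel₀ (by positivity), one_mul]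
  exact hR.le

/-! ### Exponentially weighted tails -/

/-- The density `θ e^{-θ y} 1_{y ≥ 0}` of the exponential distribution. -/
def expDensity (θ y : ℝ) : ℝ := if 0 ≤ y then θ * Real.exp (-θ * y) else 0

lemma expDensity_nonneg {θ : ℝ} (hθ : 0 ≤ θ) (y : ℝ) : 0 ≤ expDensity θ y := by
  unfold expDensity; split_ifs <;> positivity

lemma expDensity_le {θ : ℝ} (hθ : 0 ≤ θ) (y : ℝ) : expDensity θ y ≤ θ := by
  unfold expDensity; split_ifs with h
  · have : Real.exp (-θ * y) ≤ 1 := Real.exp_le_one_iff.2 (by nlinarith)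
    nlinarith
  · exact hθ

lemma measurable_expDensity (θ : ℝ) : Measurable (expDensity θ) :=
  Measurable.ite measurableSet_Ici (by fun_prop) measurable_const

/-- The one-sided regularity behind the Tauberian argument: the upward jump at `0` only helps,
because the left side vanishes for `y < h`. -/
lemma expDensity_sub_le {θ : ℝ} (hθ : 0 ≤ θ) {h : ℝ} (hh : 0 ≤ h) (y : ℝ) :
    expDensity θ (y - h) ≤ Real.exp (θ * h) * expDensity θ y := by
  by_cases hy : 0 ≤ y - h
  · rw [expDensity, expDensity, if_pos hy, if_pos (by linarith), mul_left_comm, ← Real.exp_add]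
    apply le_of_eq; congr 2; ring
  · rw [expDensity, if_neg hy]
    exact mul_nonneg (Real.exp_nonneg _) (expDensity_nonneg hθ y)

lemma expDensity_eq_indicator (θ : ℝ) :
    expDensity θ = (Set.Ici 0).indicator fun y => θ * Real.exp (-θ * y) := by
  ext y; simp [expDensity, Set.indicator_apply]

lemma integrable_expDensity {θ : ℝ} (hθ : 0 < θ) : Integrable (expDensity θ) := by
  rw [expDensity_eq_indicator, integrable_indicator_iff measurableSet_Ici,
    integrableOn_Ici_iff_integrableOn_Ioi]
  exact (integrableOn_exp_mul_Ioi (by linarith) 0).const_mul θ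

lemma integral_expDensity_mul_cexp {θ : ℝ} (hθ : 0 < θ) (t : ℝ) :
    ∫ v : ℝ, (expDensity θ v : ℂ) * cexp (-I * v * t) = θ / (θ + I * t) := by
  have h : ∀ v : ℝ, (expDensity θ v : ℂ) * cexp (-I * v * t)
      = (Set.Ici 0).indicator (fun v : ℝ => (θ : ℂ) * cexp (-(θ + I * t) * v)) v := by
    intro v
    simp only [expDensity_eq_indicator, Set.indicator_apply]
    split_ifs
    · push_cast
      rw [mul_assoc, ← Complex.exp_add]; congr 2; ring
    · simp
  simp_rw [h]
  rw [integral_indicator measurableSet_Ici, integral_Ici_eq_integral_Ioi, integral_const_mul,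
    integral_exp_mul_complex_Ioi (by simp [hθ])]
  have : (θ : ℂ) + I * t ≠ 0 := fun h => hθ.ne' (by simpa using congrArg Complex.re h)
  rw [ofReal_zero, mul_zero, Complex.exp_zero, neg_div_neg_eq, mul_one_div]

lemma integral_expDensity_add_mul_cexp {θ : ℝ} (hθ : 0 < θ) (y t : ℝ) :
    ∫ v : ℝ, (expDensity θ (y + v) : ℂ) * cexp (-I * v * t)
      = cexp (I * t * y) * (θ / (θ + I * t)) := by
  rw [← integral_expDensity_mul_cexp hθ, ← integral_const_mul,
    ← integral_add_left_eq_self (fun v : ℝ =>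
      cexp (I * t * y) * ((expDensity θ v : ℂ) * cexp (-I * v * t))) y]
  congr 1; ext v
  rw [mul_left_comm, ← Complex.exp_add]
  congr 2; push_cast; ring

/-- `∫_{x ≥ u} θ e^{-θ (x - u)} Q(dx)`. -/
def expTail (Q : Measure ℝ) (θ u : ℝ) : ℝ := ∫ x, expDensity θ (x - u) ∂Q

lemma expTail_nonneg (Q : Measure ℝ) {θ : ℝ} (hθ : 0 ≤ θ) (u : ℝ) : 0 ≤ expTail Q θ u :=
  integral_nonneg fun _ => expDensity_nonneg hθ _

section expTail

variable (Q : Measure ℝ) [IsProbabilityMeasure Q] {θ : ℝ}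

lemma integrable_expDensity_sub (hθ : 0 ≤ θ) (u : ℝ) :
    Integrable (fun x => expDensity θ (x - u)) Q :=
  Integrable.of_bound (C := θ)
    ((measurable_expDensity θ).comp (by fun_prop)).aestronglyMeasurable
    (Eventually.of_forall fun x => by
      rw [Real.norm_of_nonneg (expDensity_nonneg hθ _)]; exact expDensity_le hθ _)

lemma expTail_le (hθ : 0 ≤ θ) (u : ℝ) : expTail Q θ u ≤ θ := by
  calc expTail Q θ u ≤ ∫ _, θ ∂Q :=
        integral_mono (integrable_expDensity_sub Q hθ u) (integrable_const _)
          fun x => expDensity_le hθ _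
    _ = θ := by simp

/-- Replaces monotonicity of a tail function when smoothed and unsmoothed values are compared. -/
lemma expTail_add_le (hθ : 0 ≤ θ) {h : ℝ} (hh : 0 ≤ h) (u : ℝ) :
    expTail Q θ (u + h) ≤ Real.exp (θ * h) * expTail Q θ u := by
  rw [expTail, expTail, ← integral_const_mul]
  refine integral_mono (integrable_expDensity_sub Q hθ _)
    ((integrable_expDensity_sub Q hθ _).const_mul _) fun x => ?_
  have := expDensity_sub_le hθ hh (x - u)
  simpa only [sub_sub] using this

lemma measurable_expTail : Measurable (expTail Q θ) := by
  unfold expTail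
  refine StronglyMeasurable.measurable ?_
  refine StronglyMeasurable.integral_prod_right' (f := fun p : ℝ × ℝ => expDensity θ (p.2 - p.1)) ?_
  exact ((measurable_expDensity θ).comp (by fun_prop)).stronglyMeasurable

lemma integrable_expTail_mul (hθ : 0 ≤ θ) {K : ℝ → ℝ} (hK : Integrable K) (u : ℝ) :
    Integrable (fun v => expTail Q θ (u - v) * K v) :=
  hK.bdd_mul (c := θ) ((measurable_expTail Q).comp (by fun_prop)).aestronglyMeasurable
    (Eventually.of_forall fun v => by
      rw [Real.norm_of_nonneg (expTail_nonneg Q hθ _)]; exact expTail_le Q hθ _)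

end expTail

lemma integrable_of_continuous_of_support {τ : ℝ → ℝ} {T : ℝ} (hτ : Continuous τ)
    (hT : ∀ t, T < |t| → τ t = 0) : Integrable τ := by
  refine hτ.integrable_of_hasCompactSupport
    (HasCompactSupport.intro (K := Set.Icc (-T) T) isCompact_Icc fun x hx => hT x ?_)
  by_contra! h
  exact hx (abs_le.1 h)

lemma norm_cexp_I_mul (a b : ℝ) : ‖cexp (I * a * b)‖ = 1 := by
  have : I * a * b = ((a * b : ℝ) : ℂ) * I := by push_cast; ring
  rw [this, norm_exp_ofReal_mul_I]

lemma norm_cexp_neg_I_mul (a b : ℝ) : ‖cexp (-I * a * b)‖ = 1 := by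
  have : -I * a * b = ((-a * b : ℝ) : ℂ) * I := by push_cast; ring
  rw [this, norm_exp_ofReal_mul_I]

lemma norm_ofReal_div_add_I_mul_le {θ : ℝ} (hθ : 0 < θ) (t : ℝ) :
    ‖(θ : ℂ) / (θ + I * t)‖ ≤ 1 := by
  rw [norm_div, Complex.norm_of_nonneg hθ.le]
  refine div_le_one_of_le₀ ?_ (norm_nonneg _)
  simpa [abs_of_pos hθ] using Complex.abs_re_le_norm ((θ : ℂ) + I * t)

lemma ofReal_add_I_mul_ne_zero {θ : ℝ} (hθ : 0 < θ) (t : ℝ) : (θ : ℂ) + I * t ≠ 0 :=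
  fun h => hθ.ne' (by simpa using congrArg Complex.re h)

/-- Parseval by Fubini: `K` is written as an inverse transform, and the exponential density is
integrated against characters explicitly. -/
lemma integral_expDensity_mul_kernel {θ : ℝ} (hθ : 0 < θ) {K τ : ℝ → ℝ} (hτ : Integrable τ)
    (hK : ∀ v : ℝ, (K v : ℂ) = (1 / (2 * Real.pi) : ℝ) * ∫ t : ℝ, (τ t : ℂ) * cexp (-I * v * t))
    (y : ℝ) :
    ((∫ v, expDensity θ (y + v) * K v : ℝ) : ℂ) = (1 / (2 * Real.pi) : ℝ) *
      ∫ t : ℝ, (τ t : ℂ) * (cexp (I * t * y) * (θ / (θ + I * t))) := by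
  have hint : Integrable (fun p : ℝ × ℝ =>
      ((expDensity θ (y + p.1) : ℂ) * (τ p.2 : ℂ)) * cexp (-I * p.1 * p.2)) := by
    have h1 := ((integrable_expDensity hθ).comp_add_left y).ofReal (𝕜 := ℂ)
    refine (h1.mul_prod (hτ.ofReal (𝕜 := ℂ))).mul_bdd (c := 1)
      (Continuous.aestronglyMeasurable (by fun_prop)) (Eventually.of_forall fun p => ?_)
    exact (norm_cexp_neg_I_mul _ _).le
  have hswap := integral_integral_swap (μ := volume) (ν := volume)
    (f := fun v t : ℝ => ((expDensity θ (y + v) : ℂ) * (τ t : ℂ)) * cexp (-I * v * t)) hint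
  calc ((∫ v, expDensity θ (y + v) * K v : ℝ) : ℂ)
      = ∫ v : ℝ, (1 / (2 * Real.pi) : ℝ) *
          ∫ t : ℝ, ((expDensity θ (y + v) : ℂ) * (τ t : ℂ)) * cexp (-I * v * t) := by
        rw [← integral_complex_ofReal]
        congr 1; ext v
        push_cast
        rw [hK v]
        simp_rw [mul_assoc]
        rw [integral_const_mul]
        push_cast; ring
    _ = _ := by
        rw [integral_const_mul, hswap]
        congr 2; ext t
        rw [← integral_expDensity_add_mul_cexp hθ, ← integral_const_mul]
        congr 1; ext v; ring

/-- Smoothing the exponential tail by a band-limited kernel only sees the characteristic function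
on a bounded interval. -/
lemma integral_expTail_mul_kernel (Q : Measure ℝ) [IsProbabilityMeasure Q] {θ : ℝ} (hθ : 0 < θ)
    {K τ : ℝ → ℝ} (hKi : Integrable K) (hτ : Integrable τ)
    (hK : ∀ v : ℝ, (K v : ℂ) = (1 / (2 * Real.pi) : ℝ) * ∫ t : ℝ, (τ t : ℂ) * cexp (-I * v * t))
    (u : ℝ) :
    ((∫ v, expTail Q θ (u - v) * K v : ℝ) : ℂ) = (1 / (2 * Real.pi) : ℝ) *
      ∫ t : ℝ, (τ t : ℂ) * (charFun Q t * cexp (-I * u * t) * (θ / (θ + I * t))) := by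
  have h1 : Integrable (fun p : ℝ × ℝ => expDensity θ (p.2 - u + p.1) * K p.1)
      (volume.prod Q) := by
    refine (hKi.comp_fst Q).bdd_mul (c := θ)
      ((measurable_expDensity θ).comp (by fun_prop)).aestronglyMeasurable
      (Eventually.of_forall fun p => ?_)
    rw [Real.norm_of_nonneg (expDensity_nonneg hθ.le _)]; exact expDensity_le hθ.le _
  have h2 : Integrable (fun p : ℝ × ℝ =>
      (τ p.2 : ℂ) * (cexp (I * p.2 * (p.1 - u)) * (θ / (θ + I * p.2)))) (Q.prod volume) := by
    refine ((hτ.ofReal (𝕜 := ℂ)).comp_snd Q).mul_bdd (c := 1) ?_ (Eventually.of_forall fun p => ?_)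
    · refine Continuous.aestronglyMeasurable ?_
      have : ∀ p : ℝ × ℝ, (θ : ℂ) + I * p.2 ≠ 0 := fun p => ofReal_add_I_mul_ne_zero hθ _
      fun_prop (disch := assumption)
    · have := norm_cexp_I_mul p.2 (p.1 - u)
      push_cast at this
      rw [norm_mul, this, one_mul]
      exact norm_ofReal_div_add_I_mul_le hθ _
  -- The first exchange brings `Q` outside the kernel integral; after Parseval for fixed `x`, the
  -- second brings `Q` back inside, where it produces `charFun Q t`.
  have hs1 := integral_integral_swap (f := fun v x : ℝ => expDensity θ (x - u + v) * K v) h1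
  have hs2 := integral_integral_swap (f := fun x t : ℝ =>
    (τ t : ℂ) * (cexp (I * t * (x - u)) * (θ / (θ + I * t)))) h2
  have h3 : ∫ v, expTail Q θ (u - v) * K v = ∫ x, ∫ v, expDensity θ (x - u + v) * K v ∂volume ∂Q := by
    rw [← hs1]
    congr 1; ext v
    rw [integral_mul_const, expTail]
    congr 2; ext x; congr 1; ring
  rw [h3, ← integral_complex_ofReal]
  have h4 : ∀ x : ℝ, ((∫ v, expDensity θ (x - u + v) * K v : ℝ) : ℂ) = (1 / (2 * Real.pi) : ℝ) *
      ∫ t : ℝ, (τ t : ℂ) * (cexp (I * t * (x - u)) * (θ / (θ + I * t))) := by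
    intro x
    rw [integral_expDensity_mul_kernel hθ hτ hK]
    push_cast; rfl
  simp_rw [h4]
  rw [integral_const_mul, hs2]
  congr 2; ext t
  rw [integral_const_mul, charFun_apply_real, ← integral_mul_const, ← integral_mul_const]
  congr 2; ext x
  rw [← Complex.exp_add]; congr 2; ring

/-! ### A Tauberian smoothing theorem -/

/-- The exponential tail of `Q`, smoothed by the kernel `K`. -/
def smoothedTail (Q : Measure ℝ) (θ : ℝ) (K : ℝ → ℝ) (u : ℝ) : ℝ :=
  ∫ v, expTail Q θ (u - v) * K v

/-- Centring the smoothing at `u - η` puts every point `u - η - v`, `|v| ≤ η`, in `[u - 2η, u]`. So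
`expTail_add_le` applies in its one direction, at a cost of at most `e^{2θη}`. -/
lemma mul_expTail_le_smoothedTail (Q : Measure ℝ) [IsProbabilityMeasure Q] {θ : ℝ} (hθ : 0 ≤ θ)
    {K : ℝ → ℝ} (hK : IsBandLimited K) {η : ℝ} (u : ℝ) :
    Real.exp (-(2 * θ * η)) * (∫ v in Set.Icc (-η) η, K v) * expTail Q θ u
      ≤ smoothedTail Q θ K (u - η) := by
  have hi := integrable_expTail_mul Q hθ hK.integrable (u - η)
  calc _ = ∫ v in Set.Icc (-η) η, Real.exp (-(2 * θ * η)) * expTail Q θ u * K v := by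
        rw [integral_const_mul]; ring
    _ ≤ ∫ v in Set.Icc (-η) η, expTail Q θ (u - η - v) * K v := by
        refine setIntegral_mono_on (hK.integrable.const_mul _).integrableOn hi.integrableOn
          measurableSet_Icc fun v hv => ?_
        refine mul_le_mul_of_nonneg_right ?_ (hK.nonneg v)
        have h1 := expTail_add_le Q hθ (h := η + v) (by linarith [hv.1]) (u - η - v)
        rw [show u - η - v + (η + v) = u by ring] at h1
        have h2 : Real.exp (θ * (η + v)) ≤ Real.exp (2 * θ * η) :=
          Real.exp_le_exp.2 (by nlinarith [hv.2])
        rw [Real.exp_neg, inv_mul_le_iff₀ (Real.exp_pos _)]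
        exact h1.trans (mul_le_mul_of_nonneg_right h2 (expTail_nonneg Q hθ _))
    _ ≤ _ := setIntegral_le_integral hi
        (Eventually.of_forall fun v => mul_nonneg (expTail_nonneg Q hθ _) (hK.nonneg v))

/-- The mirror image: centred at `η`, the window samples `[0, 2η]`. The mass outside the window is
only controlled by an a priori bound `B` uniform in `u`. -/
lemma smoothedTail_le (Q : Measure ℝ) [IsProbabilityMeasure Q] {θ : ℝ} (hθ : 0 ≤ θ)
    {K : ℝ → ℝ} (hK : IsBandLimited K) {η ε B : ℝ}
    (hε : 1 - ε ≤ ∫ v in Set.Icc (-η) η, K v) (hB : ∀ u, expTail Q θ u ≤ B) :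
    smoothedTail Q θ K η ≤ Real.exp (2 * θ * η) * expTail Q θ 0 + B * ε := by
  have hi := integrable_expTail_mul Q hθ hK.integrable η
  have hB0 : 0 ≤ B := (expTail_nonneg Q hθ 0).trans (hB 0)
  have hc : ∫ v in (Set.Icc (-η) η)ᶜ, K v ≤ ε := by
    have := integral_add_compl (measurableSet_Icc (a := -η) (b := η)) hK.integrable
    rw [hK.integral_eq_one] at this
    linarith
  have h1 : ∫ v in Set.Icc (-η) η, K v ≤ 1 := by
    rw [← hK.integral_eq_one]
    exact setIntegral_le_integral hK.integrable (Eventually.of_forall hK.nonneg)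
  rw [smoothedTail, ← integral_add_compl (measurableSet_Icc (a := -η) (b := η)) hi]
  refine add_le_add ?_ ?_
  · calc _ ≤ ∫ v in Set.Icc (-η) η, Real.exp (2 * θ * η) * expTail Q θ 0 * K v := by
          refine setIntegral_mono_on hi.integrableOn (hK.integrable.const_mul _).integrableOn
            measurableSet_Icc fun v hv => ?_
          refine mul_le_mul_of_nonneg_right ?_ (hK.nonneg v)
          have h2 := expTail_add_le Q hθ (h := η - v) (by linarith [hv.2]) 0
          rw [zero_add] at h2
          have h3 : Real.exp (θ * (η - v)) ≤ Real.exp (2 * θ * η) :=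
            Real.exp_le_exp.2 (by nlinarith [hv.1])
          exact h2.trans (mul_le_mul_of_nonneg_right h3 (expTail_nonneg Q hθ _))
      _ = Real.exp (2 * θ * η) * expTail Q θ 0 * ∫ v in Set.Icc (-η) η, K v := by
          rw [integral_const_mul]
      _ ≤ _ := mul_le_of_le_one_right (mul_nonneg (Real.exp_nonneg _) (expTail_nonneg Q hθ _)) h1
  · calc _ ≤ ∫ v in (Set.Icc (-η) η)ᶜ, B * K v := by
          refine integral_mono hi.integrableOn (hK.integrable.const_mul _).integrableOn fun v => ?_
          exact mul_le_mul_of_nonneg_right (hB _) (hK.nonneg v)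
      _ ≤ B * ε := by
          rw [integral_const_mul]; gcongr

/-- If all the band-limited smoothings of the exponential tails converge to `1`, then so do the
exponential tails themselves. -/
theorem tendsto_expTail_of_smoothedTail (Q : ℕ → Measure ℝ) [∀ n, IsProbabilityMeasure (Q n)]
    {θ s : ℕ → ℝ} {θ₁ : ℝ} (hθ : ∀ᶠ n in atTop, 0 ≤ θ n ∧ θ n ≤ θ₁) (hs : ∀ n, 0 ≤ s n)
    (hlim : ∀ K, IsBandLimited K → ∀ u,
      Tendsto (fun n => s n * smoothedTail (Q n) (θ n) K u) atTop (𝓝 1))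
    (hbdd : ∀ K, IsBandLimited K → ∃ C, ∀ᶠ n in atTop, ∀ u,
      s n * smoothedTail (Q n) (θ n) K u ≤ C) :
    Tendsto (fun n => s n * expTail (Q n) (θ n) 0) atTop (𝓝 1) := by
  -- A single kernel with half its mass in `[-1/2, 1/2]` gives the a priori bound required by
  -- `smoothedTail_le`.
  obtain ⟨B, hB⟩ : ∃ B, ∀ᶠ n in atTop, ∀ u, s n * expTail (Q n) (θ n) u ≤ B := by
    obtain ⟨K, hK, hm⟩ := exists_isBandLimited_concentrated (ε := 1 / 2) (by norm_num)
    obtain ⟨C, hC⟩ := hbdd K hK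
    refine ⟨Real.exp θ₁ * 2 * C, ?_⟩
    filter_upwards [hC, hθ] with n hn hθn u
    have h1 := mul_expTail_le_smoothedTail (Q n) hθn.1 hK (η := 1 / 2) u
    have h2 : Real.exp (-θ₁) * (1 / 2) ≤
        Real.exp (-(2 * θ n * (1 / 2))) * ∫ v in Set.Icc (-(1 / 2)) (1 / 2), K v := by
      refine mul_le_mul (Real.exp_le_exp.2 (by linarith)) (by linarith) (by norm_num)
        (Real.exp_nonneg _)
    have h3 := mul_le_mul_of_nonneg_left ((mul_le_mul_of_nonneg_right h2
      (expTail_nonneg (Q n) hθn.1 u)).trans h1) (hs n)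
    have h4 := h3.trans (hn _)
    rw [Real.exp_neg] at h4
    have := Real.exp_pos θ₁
    field_simp at h4
    linarith
  -- For each `ε`, the two smoothing inequalities eventually confine the quantity between this
  -- expression and the one in `hc2`.
  have hc1 : Tendsto (fun ε : ℝ => Real.exp (-(2 * θ₁ * ε)) * (1 - ε - B * ε)) (𝓝[>] 0) (𝓝 1) := by
    have : Continuous (fun ε : ℝ => Real.exp (-(2 * θ₁ * ε)) * (1 - ε - B * ε)) := by fun_prop
    exact tendsto_nhdsWithin_of_tendsto_nhds (by simpa using this.tendsto 0)
  have hc2 : Tendsto (fun ε : ℝ => Real.exp (2 * θ₁ * ε) * (1 + ε) / (1 - ε)) (𝓝[>] 0) (𝓝 1) := by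
    have : ContinuousAt (fun ε : ℝ => Real.exp (2 * θ₁ * ε) * (1 + ε) / (1 - ε)) 0 := by
      apply ContinuousAt.div (by fun_prop) (by fun_prop) (by norm_num)
    exact tendsto_nhdsWithin_of_tendsto_nhds (by simpa [ContinuousAt] using this)
  have hself : Tendsto (fun ε : ℝ => ε) (𝓝[>] 0) (𝓝 0) := tendsto_nhdsWithin_of_tendsto_nhds tendsto_id
  rw [tendsto_order]
  constructor
  · intro a ha
    obtain ⟨ε, ⟨hε, hε0⟩⟩ := ((hc1.eventually (lt_mem_nhds ha)).and self_mem_nhdsWithin).exists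
    obtain ⟨K, hK, hm⟩ := exists_isBandLimited_concentrated (ε := ε) hε0
    filter_upwards [hB, hθ, (hlim K hK ε).eventually (lt_mem_nhds (show 1 - ε < 1 by
      linarith [hε0]))] with n hBn hθn hn
    refine hε.trans_le ?_
    have h1 : s n * smoothedTail (Q n) (θ n) K ε
        ≤ Real.exp (2 * θ n * ε) * (s n * expTail (Q n) (θ n) 0) + B * ε := by
      have hB0 : 0 ≤ B := (mul_nonneg (hs n) (expTail_nonneg (Q n) hθn.1 0)).trans (hBn 0)
      rcases (hs n).eq_or_lt with h0 | h0
      · rw [← h0]; simp; exact mul_nonneg hB0 (le_of_lt hε0)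
      · have := smoothedTail_le (Q n) hθn.1 hK hm (B := B / s n) fun u => by
          rw [le_div_iff₀ h0]; linarith [hBn u]
        have := mul_le_mul_of_nonneg_left this h0.le
        calc _ ≤ _ := this
          _ = _ := by field_simp
    have h2 : Real.exp (2 * θ n * ε) ≤ Real.exp (2 * θ₁ * ε) :=
      Real.exp_le_exp.2 (by nlinarith [hε0])
    have h3 := mul_le_mul_of_nonneg_right h2 (mul_nonneg (hs n) (expTail_nonneg (Q n) hθn.1 0))
    rw [Real.exp_neg, inv_mul_le_iff₀ (Real.exp_pos _)]
    linarith
  · intro a ha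
    obtain ⟨ε, ⟨⟨hε, hε1⟩, hε0⟩⟩ := (((hc2.eventually (gt_mem_nhds ha)).and
      (hself.eventually (gt_mem_nhds one_pos))).and self_mem_nhdsWithin).exists
    have hε0' : 0 < ε := hε0
    obtain ⟨K, hK, hm⟩ := exists_isBandLimited_concentrated (ε := ε) hε0
    filter_upwards [hθ, (hlim K hK (0 - ε)).eventually (gt_mem_nhds (show 1 < 1 + ε by
      linarith))] with n hθn hn
    refine lt_of_le_of_lt ?_ hε
    have h1 := mul_expTail_le_smoothedTail (Q n) hθn.1 hK (η := ε) 0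
    have h2 : Real.exp (-(2 * θ₁ * ε)) * (1 - ε) ≤
        Real.exp (-(2 * θ n * ε)) * ∫ v in Set.Icc (-ε) ε, K v :=
      mul_le_mul (Real.exp_le_exp.2 (by nlinarith)) hm (by linarith) (Real.exp_nonneg _)
    have h3 := (mul_le_mul_of_nonneg_left ((mul_le_mul_of_nonneg_right h2
      (expTail_nonneg (Q n) hθn.1 0)).trans h1) (hs n)).trans hn.le
    rw [le_div_iff₀ (by linarith)]
    rw [Real.exp_neg] at h3
    have := Real.exp_pos (2 * θ₁ * ε)
    field_simp at h3
    linarith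

/-! ### A local limit theorem in terms of characteristic functions -/

/-- Substitute `t = x / N n` in the Fourier formula for the smoothed tail. The factors `τ`,
`e^{-iut}` and `θ / (θ + i t)` tend to `1`, the last because `θ n ≥ θ₀ > 0`, leaving a Gaussian
integral. Domination is needed only for `|t| ≤ T`, since `τ` vanishes beyond. -/
theorem tendsto_expTail_of_charFun (Q : ℕ → Measure ℝ) [∀ n, IsProbabilityMeasure (Q n)]
    {θ N : ℕ → ℝ} {θ₀ θ₁ : ℝ} (hθ₀ : 0 < θ₀) (hθ : ∀ᶠ n in atTop, θ₀ ≤ θ n ∧ θ n ≤ θ₁)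
    (hN0 : ∀ n, 0 ≤ N n) (hN : Tendsto N atTop atTop)
    (hψ : ∀ x : ℝ, Tendsto (fun n => charFun (Q n) (x / N n)) atTop
      (𝓝 (Real.exp (-(x ^ 2) / 2) : ℝ)))
    (hdom : ∀ T : ℝ, ∃ c > 0, ∀ᶠ n in atTop, ∀ t : ℝ, |t| ≤ T →
      ‖charFun (Q n) t‖ ≤ Real.exp (-c * (N n * t) ^ 2)) :
    Tendsto (fun n => √(2 * Real.pi) * N n * expTail (Q n) (θ n) 0) atTop (𝓝 1) := by
  have hpi := Real.pi_pos
  refine tendsto_expTail_of_smoothedTail Q (hθ.mono fun n h => ⟨hθ₀.le.trans h.1, h.2⟩)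
    (fun n => mul_nonneg (Real.sqrt_nonneg _) (hN0 n)) ?_ ?_
  · intro K hK u
    obtain ⟨T, τ, hT, hτ, hτ0, hτ1, hτT, hKτ⟩ := hK.exists_transform
    obtain ⟨c, hc, hdomc⟩ := hdom T
    have hτi := integrable_of_continuous_of_support hτ hτT
    have key : Tendsto (fun n => ∫ x : ℝ, (τ (x / N n) : ℂ) * (charFun (Q n) (x / N n) *
        cexp (-I * u * (x / N n : ℝ)) * (θ n / (θ n + I * (x / N n : ℝ))))) atTop
        (𝓝 (∫ x : ℝ, ((Real.exp (-(x ^ 2) / 2) : ℝ) : ℂ))) := by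
      refine tendsto_integral_filter_of_dominated_convergence (fun x => Real.exp (-c * x ^ 2))
        ?_ ?_ (integrable_exp_neg_mul_sq hc) ?_
      · filter_upwards [hθ] with n hn
        have h0 : ∀ x : ℝ, (θ n : ℂ) + I * (x / N n : ℝ) ≠ 0 := fun x =>
          ofReal_add_I_mul_ne_zero (hθ₀.trans_le hn.1) _
        have h1 : Continuous (charFun (Q n)) := continuous_charFun
        exact Continuous.aestronglyMeasurable (by fun_prop (disch := assumption))
      · filter_upwards [hθ, hdomc, hN.eventually_gt_atTop 0] with n hn hdn hNn
        refine Eventually.of_forall fun x => ?_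
        by_cases hx : T < |x / N n|
        · rw [hτT _ hx]; simpa using Real.exp_nonneg _
        · have h1 := hdn _ (not_lt.1 hx)
          rw [show N n * (x / N n) = x by field_simp] at h1
          rw [norm_mul, norm_mul, norm_mul, norm_cexp_neg_I_mul, mul_one, Complex.norm_real,
            Real.norm_eq_abs]
          calc _ ≤ 1 * (‖charFun (Q n) (x / N n)‖ * 1) := by
                gcongr
                · exact hτ1 _
                · exact norm_ofReal_div_add_I_mul_le (hθ₀.trans_le hn.1) _
            _ ≤ _ := by linarith
      · refine Eventually.of_forall fun x => ?_
        have hx : Tendsto (fun n => x / N n) atTop (𝓝 0) := hN.const_div_atTop x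
        have h1 : Tendsto (fun n => (τ (x / N n) : ℂ)) atTop (𝓝 1) := by
          have := (continuous_ofReal.comp hτ).tendsto 0
          simp only [Function.comp_def, hτ0, ofReal_one] at this
          exact this.comp hx
        have h2 : Tendsto (fun n => cexp (-I * u * (x / N n : ℝ))) atTop (𝓝 1) := by
          have : Continuous fun y : ℝ => cexp (-I * u * y) := by fun_prop
          have := this.tendsto 0
          simp only [ofReal_zero, mul_zero, Complex.exp_zero] at this
          exact this.comp hx
        have h3 : Tendsto (fun n => (θ n : ℂ) / (θ n + I * (x / N n : ℝ))) atTop (𝓝 1) := by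
          rw [tendsto_iff_norm_sub_tendsto_zero]
          refine squeeze_zero' (Eventually.of_forall fun _ => norm_nonneg _) ?_
            (by simpa using hx.abs.div_const θ₀)
          filter_upwards [hθ] with n hn
          have hpos := hθ₀.trans_le hn.1
          have h0 := ofReal_add_I_mul_ne_zero hpos (x / N n)
          have : (θ n : ℂ) / (θ n + I * (x / N n : ℝ)) - 1
              = -(I * (x / N n : ℝ)) / (θ n + I * (x / N n : ℝ)) := by
            field_simp; ring
          rw [this, norm_div, norm_neg, norm_mul, norm_I, one_mul, Complex.norm_real,
            Real.norm_eq_abs]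
          gcongr
          have := Complex.abs_re_le_norm ((θ n : ℂ) + I * (x / N n : ℝ))
          simp only [add_re, ofReal_re, mul_re, I_re, zero_mul, I_im, ofReal_im, mul_zero, sub_zero,
            add_zero, abs_of_pos hpos] at this
          linarith [hn.1]
        simpa using h1.mul (((hψ x).mul h2).mul h3)
    rw [integral_complex_ofReal] at key
    have hg : ∫ x : ℝ, Real.exp (-(x ^ 2) / 2) = √(2 * Real.pi) := by
      have := integral_gaussian (1 / 2)
      rw [show Real.pi / (1 / 2) = 2 * Real.pi by ring] at this
      rw [← this]; congr 1; ext x; congr 1; ring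
    rw [hg] at key
    have key2 := key.const_mul ((√(2 * Real.pi) / (2 * Real.pi) : ℝ) : ℂ)
    rw [← ofReal_mul, show √(2 * Real.pi) / (2 * Real.pi) * √(2 * Real.pi) = 1 by
      rw [div_mul_eq_mul_div, Real.mul_self_sqrt (by positivity)]; field_simp] at key2
    have key3 := (Complex.continuous_re.tendsto _).comp key2
    rw [ofReal_re] at key3
    refine key3.congr' ?_
    filter_upwards [hθ, hN.eventually_gt_atTop 0] with n hn hNn
    rw [Function.comp_apply, ← ofReal_re (√(2 * Real.pi) * N n * smoothedTail (Q n) (θ n) K u)]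
    congr 1
    rw [ofReal_mul, smoothedTail,
      integral_expTail_mul_kernel (Q n) (hθ₀.trans_le hn.1) hK.integrable hτi hKτ,
      Measure.integral_comp_div (fun t : ℝ => (τ t : ℂ) * (charFun (Q n) t *
        cexp (-I * u * t) * (θ n / (θ n + I * t)))), abs_of_pos hNn, real_smul]
    push_cast; ring
  -- Taking norms removes the phase `e^{-iut}`, so the resulting bound is uniform in `u`.
  · intro K hK
    obtain ⟨T, τ, hT, hτ, hτ0, hτ1, hτT, hKτ⟩ := hK.exists_transform
    obtain ⟨c, hc, hdomc⟩ := hdom T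
    have hτi := integrable_of_continuous_of_support hτ hτT
    refine ⟨√(2 * Real.pi) * √(Real.pi / c), ?_⟩
    filter_upwards [hθ, hdomc, hN.eventually_gt_atTop 0] with n hn hdn hNn u
    have h1 : smoothedTail (Q n) (θ n) K u ≤ 1 * √(Real.pi / (c * N n ^ 2)) := by
      refine (Real.le_norm_self _).trans ?_
      rw [← Complex.norm_real, smoothedTail,
        integral_expTail_mul_kernel (Q n) (hθ₀.trans_le hn.1) hK.integrable hτi hKτ, norm_mul,
        ← integral_gaussian]
      gcongr
      · rw [Complex.norm_of_nonneg (by positivity), div_le_one (by positivity)]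
        linarith [Real.pi_gt_three]
      · refine norm_integral_le_of_norm_le (integrable_exp_neg_mul_sq (by positivity))
          (Eventually.of_forall fun t => ?_)
        by_cases ht : T < |t|
        · rw [hτT _ ht]; simpa using Real.exp_nonneg _
        · rw [norm_mul, norm_mul, norm_mul, norm_cexp_neg_I_mul, mul_one, Complex.norm_real,
            Real.norm_eq_abs]
          calc _ ≤ 1 * (‖charFun (Q n) t‖ * 1) := by
                gcongr
                · exact hτ1 _
                · exact norm_ofReal_div_add_I_mul_le (hθ₀.trans_le hn.1) _
            _ ≤ Real.exp (-c * (N n * t) ^ 2) := by linarith [hdn t (not_lt.1 ht)]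
            _ = _ := by congr 1; ring
    rw [one_mul] at h1
    calc _ ≤ √(2 * Real.pi) * N n * √(Real.pi / (c * N n ^ 2)) := by gcongr
      _ = √(2 * Real.pi) * √(Real.pi / c) := by
        rw [← div_div,
          Real.sqrt_div' _ (by positivity), Real.sqrt_sq hNn.le]
        field_simp

/-! ### Second-order Taylor bounds for `e^{iy}`. -/

lemma norm_cexp_I_mul_sub_taylor_le_of_le_one {y : ℝ} (hy : |y| ≤ 1) :
    ‖cexp (I * y) - 1 - I * y + y ^ 2 / 2‖ ≤ |y| ^ 3 := by
  have h1 := Complex.exp_bound (x := I * y) (by simpa using hy) (n := 3) (by norm_num)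
  simp only [Finset.sum_range_succ, Finset.sum_range_zero, norm_mul, norm_I, one_mul,
    Complex.norm_real, Real.norm_eq_abs] at h1
  have h2 : cexp (I * y) - (0 + (I * y) ^ 0 / (Nat.factorial 0) + (I * y) ^ 1 / (Nat.factorial 1)
      + (I * y) ^ 2 / (Nat.factorial 2)) = cexp (I * y) - 1 - I * y + y ^ 2 / 2 := by
    simp [Nat.factorial, mul_pow]; ring
  rw [h2] at h1
  refine h1.trans ?_
  have : 0 ≤ |y| ^ 3 := by positivity
  norm_num [Nat.factorial]
  linarith

/-- The Lindeberg argument needs both: the quadratic bound costs only a variance and serves large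
weights, the cubic one gains an order and serves bounded weights. -/
lemma norm_cexp_I_mul_sub_taylor_le (y : ℝ) :
    ‖cexp (I * y) - 1 - I * y + y ^ 2 / 2‖ ≤ 4 * y ^ 2 ∧
    ‖cexp (I * y) - 1 - I * y + y ^ 2 / 2‖ ≤ 4 * |y| ^ 3 := by
  have habs := abs_nonneg y
  have hsq := sq_abs y
  rcases le_total |y| 1 with hy | hy
  · have := norm_cexp_I_mul_sub_taylor_le_of_le_one hy
    have h3 : |y| ^ 3 ≤ |y| ^ 2 := pow_le_pow_of_le_one habs hy (by norm_num)
    have : 0 ≤ |y| ^ 3 := by positivity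
    constructor <;> linarith
  · have h1 : ‖cexp (I * y) - 1 - I * y + y ^ 2 / 2‖ ≤ 1 + 1 + |y| + |y| ^ 2 / 2 := by
      refine (norm_add_le _ _).trans (add_le_add ((norm_sub_le _ _).trans
        (add_le_add ((norm_sub_le _ _).trans (add_le_add ?_ ?_)) ?_)) ?_)
      · rw [mul_comm, norm_exp_ofReal_mul_I]
      · simp
      · simp
      · simp
    have h2 : |y| ≤ |y| ^ 2 := by nlinarith
    have h3 : |y| ^ 2 ≤ |y| ^ 3 := pow_le_pow_right₀ hy (by norm_num)
    constructor <;> linarith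

variable {Ω : Type*} [MeasurableSpace Ω]

/-! ### Exponentially tilted characteristic functions -/

section Tilted

variable {X : Ω → ℝ} {μ : Measure Ω}

lemma mem_interior_integrableExpSet_of_forall
    (h : ∀ t : ℝ, Integrable (fun ω => Real.exp (t * X ω)) μ) (t : ℝ) :
    t ∈ interior (integrableExpSet X μ) := by
  have : integrableExpSet X μ = Set.univ := Set.eq_univ_of_forall h
  simp [this]

lemma contDiff_cgf (h : ∀ t : ℝ, Integrable (fun ω => Real.exp (t * X ω)) μ) (n : ℕ) :
    ContDiff ℝ n (cgf X μ) :=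
  contDiff_iff_contDiffAt.2 fun t =>
    (analyticAt_cgf (mem_interior_integrableExpSet_of_forall h t)).contDiffAt

lemma hasDerivAt_cgf (h : ∀ t : ℝ, Integrable (fun ω => Real.exp (t * X ω)) μ) (t : ℝ) :
    HasDerivAt (cgf X μ) (deriv (cgf X μ) t) t :=
  ((contDiff_cgf h 1).differentiable (by simp) t).hasDerivAt

lemma hasDerivAt_deriv_cgf (h : ∀ t : ℝ, Integrable (fun ω => Real.exp (t * X ω)) μ) (t : ℝ) :
    HasDerivAt (deriv (cgf X μ)) (iteratedDeriv 2 (cgf X μ) t) t := by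
  rw [iteratedDeriv_succ, iteratedDeriv_one]
  have h2 : ContDiff ℝ 1 (deriv (cgf X μ)) := (contDiff_cgf h 2).deriv' (n := 1)
  exact (h2.differentiable (by simp) t).hasDerivAt

lemma continuous_deriv_cgf (h : ∀ t : ℝ, Integrable (fun ω => Real.exp (t * X ω)) μ) :
    Continuous (deriv (cgf X μ)) :=
  (contDiff_cgf h 1).continuous_deriv le_rfl

lemma continuous_iteratedDeriv_two_cgf
    (h : ∀ t : ℝ, Integrable (fun ω => Real.exp (t * X ω)) μ) :
    Continuous (iteratedDeriv 2 (cgf X μ)) :=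
  (contDiff_cgf h 2).continuous_iteratedDeriv 2 le_rfl

variable (X μ) in
/-- The characteristic function of the centred variable `X - E X` under the exponential tilt of `μ`
by `η X`. -/
def tiltedCharFun (η s : ℝ) : ℂ :=
  ∫ ω, cexp (I * s * (X ω - deriv (cgf X μ) η : ℝ)) ∂(μ.tilted (η * X ·))

/-- Passing to `complexMGF` gives joint continuity by analyticity and the product formula by
independence. -/
lemma tiltedCharFun_eq (η s : ℝ) : tiltedCharFun X μ η s =
    complexMGF X μ (η + s * I) / mgf X μ η * cexp (-(I * s * deriv (cgf X μ) η)) := by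
  rw [tiltedCharFun, integral_tilted_mul_eq_mgf, complexMGF, ← integral_div, ← integral_mul_const]
  congr 1; ext ω
  rw [real_smul, ofReal_div, ofReal_exp, div_mul_eq_mul_div, div_mul_eq_mul_div, ← Complex.exp_add,
    ← Complex.exp_add]
  congr 2; push_cast; ring

variable (X μ) in
/-- `s X` takes a.s. values in a single coset of `2π ℤ`. -/
def ArithmeticAt (s : ℝ) : Prop := ∃ β : ℝ, ∀ᵐ ω ∂μ, ∃ k : ℤ, s * X ω = β + k * (2 * Real.pi)

lemma integral_tilted_sub_sq (h : ∀ t : ℝ, Integrable (fun ω => Real.exp (t * X ω)) μ) (η : ℝ) :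
    ∫ ω, (X ω - deriv (cgf X μ) η) ^ 2 ∂(μ.tilted (η * X ·)) = iteratedDeriv 2 (cgf X μ) η := by
  have hi := mem_interior_integrableExpSet_of_forall h η
  rw [← variance_tilted_mul hi, variance_eq_integral
    (memLp_tilted_mul hi 1).aestronglyMeasurable.aemeasurable, integral_tilted_mul_self hi]

lemma iteratedDeriv_two_cgf_nonneg
    (h : ∀ t : ℝ, Integrable (fun ω => Real.exp (t * X ω)) μ) (η : ℝ) : 0 ≤ iteratedDeriv 2 (cgf X μ) η := by
  rw [← integral_tilted_sub_sq h]; exact integral_nonneg fun _ => sq_nonneg _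

variable [IsProbabilityMeasure μ] (h : ∀ t : ℝ, Integrable (fun ω => Real.exp (t * X ω)) μ)

include h

lemma continuous_tiltedCharFun : Continuous fun p : ℝ × ℝ => tiltedCharFun X μ p.1 p.2 := by
  have h1 : Continuous (complexMGF X μ) := by
    refine continuous_iff_continuousAt.2 fun z => ?_
    exact (analyticAt_complexMGF (mem_interior_integrableExpSet_of_forall h _)).continuousAt
  have h2 : Continuous (mgf X μ) := continuous_mgf h
  have h3 := continuous_deriv_cgf h
  have h4 : ∀ p : ℝ × ℝ, (mgf X μ p.1 : ℂ) ≠ 0 := fun p => by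
    exact_mod_cast (mgf_pos (h p.1)).ne'
  simp_rw [tiltedCharFun_eq]
  fun_prop (disch := assumption)

lemma isProbabilityMeasure_tilted_mul (η : ℝ) : IsProbabilityMeasure (μ.tilted (η * X ·)) :=
  isProbabilityMeasure_tilted (h η)

lemma norm_tiltedCharFun_le_one (η s : ℝ) : ‖tiltedCharFun X μ η s‖ ≤ 1 := by
  have := isProbabilityMeasure_tilted_mul h η
  refine (norm_integral_le_of_norm_le_const (C := 1) (Eventually.of_forall fun ω => ?_)).trans ?_
  · exact (norm_cexp_I_mul _ _).le
  · simp

lemma integral_tilted_sub (η : ℝ) :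
    ∫ ω, (X ω - deriv (cgf X μ) η) ∂(μ.tilted (η * X ·)) = 0 := by
  have := isProbabilityMeasure_tilted_mul h η
  have hm := memLp_tilted_mul (mem_interior_integrableExpSet_of_forall h η) 1
  rw [integral_sub (memLp_one_iff_integrable.1 (by simpa using hm)) (integrable_const _),
    integral_tilted_mul_self (mem_interior_integrableExpSet_of_forall h η)]
  simp

lemma memLp_tilted_sub (η : ℝ) (p : NNReal) :
    MemLp (fun ω => X ω - deriv (cgf X μ) η) p (μ.tilted (η * X ·)) := by
  have := isProbabilityMeasure_tilted_mul h η
  exact (memLp_tilted_mul (mem_interior_integrableExpSet_of_forall h η) p).sub (memLp_const _)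

/-- A vanishing tilted variance makes `X` constant almost surely for the tilted measure, hence for
`μ`, because the tilting density is positive. -/
lemma iteratedDeriv_two_cgf_pos (hX : ¬ ∃ c : ℝ, ∀ᵐ ω ∂μ, X ω = c) (η : ℝ) :
    0 < iteratedDeriv 2 (cgf X μ) η := by
  refine lt_of_le_of_ne (iteratedDeriv_two_cgf_nonneg h η) fun h0 => hX ?_
  rw [← integral_tilted_sub_sq h, eq_comm, integral_eq_zero_iff_of_nonneg
    (fun _ => sq_nonneg _) (memLp_tilted_sub h η 2).integrable_sq] at h0
  refine ⟨deriv (cgf X μ) η, ?_⟩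
  have := (absolutelyContinuous_tilted (h η)).ae_le h0
  filter_upwards [this] with ω hω
  simpa [sub_eq_zero] using hω

/-- The linear term integrates to zero because `cgf'` is the tilted mean, and the quadratic one
gives the tilted variance `cgf''`. -/
lemma tiltedCharFun_sub_taylor_eq (η s : ℝ) :
    tiltedCharFun X μ η s - 1 + s ^ 2 * iteratedDeriv 2 (cgf X μ) η / 2 =
    ∫ ω, (cexp (I * (s * (X ω - deriv (cgf X μ) η) : ℝ)) - 1
      - I * (s * (X ω - deriv (cgf X μ) η) : ℝ)
      + ((s * (X ω - deriv (cgf X μ) η) : ℝ) : ℂ) ^ 2 / 2) ∂(μ.tilted (η * X ·)) := by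
  have := isProbabilityMeasure_tilted_mul h η
  set Y := fun ω => X ω - deriv (cgf X μ) η with hY
  have hY1 : Integrable Y (μ.tilted (η * X ·)) :=
    memLp_one_iff_integrable.1 (by simpa using memLp_tilted_sub h η 1)
  have hY2 : Integrable (fun ω => Y ω ^ 2) (μ.tilted (η * X ·)) :=
    (memLp_tilted_sub h η 2).integrable_sq
  have hme : AEStronglyMeasurable Y (μ.tilted (η * X ·)) := hY1.aestronglyMeasurable
  have hexp : Integrable (fun ω => cexp (I * (s * Y ω : ℝ))) (μ.tilted (η * X ·)) := by
    refine Integrable.of_bound (C := 1) ?_ (Eventually.of_forall fun ω => ?_)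
    · have : Continuous fun y : ℝ => cexp (I * (s * y : ℝ)) := by fun_prop
      exact this.comp_aestronglyMeasurable hme
    · rw [mul_comm, norm_exp_ofReal_mul_I]
  have hlin : Integrable (fun ω => I * ((s * Y ω : ℝ) : ℂ)) (μ.tilted (η * X ·)) :=
    ((hY1.const_mul s).ofReal (𝕜 := ℂ)).const_mul I
  have hsq : Integrable (fun ω => (((s * Y ω : ℝ) : ℂ)) ^ 2 / 2) (μ.tilted (η * X ·)) := by
    have := ((hY2.const_mul (s ^ 2)).ofReal (𝕜 := ℂ)).div_const 2
    refine this.congr (Eventually.of_forall fun ω => ?_)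
    simp [mul_pow]
  have h1 := integral_tilted_sub h η
  have h2 := integral_tilted_sub_sq h η
  change ∫ ω, Y ω ∂_ = 0 at h1
  change ∫ ω, Y ω ^ 2 ∂_ = _ at h2
  have hA : Integrable (fun ω => cexp (I * (s * Y ω : ℝ)) - 1) (μ.tilted (η * X ·)) :=
    hexp.sub (integrable_const _)
  have hB : Integrable (fun ω => cexp (I * (s * Y ω : ℝ)) - 1 - I * ((s * Y ω : ℝ) : ℂ))
      (μ.tilted (η * X ·)) := hA.sub hlin
  change _ = ∫ ω, (cexp (I * (s * Y ω : ℝ)) - 1 - I * ((s * Y ω : ℝ) : ℂ)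
    + ((s * Y ω : ℝ) : ℂ) ^ 2 / 2) ∂(μ.tilted (η * X ·))
  rw [integral_add hB hsq, integral_sub hA hlin, integral_sub hexp (integrable_const _),
    integral_const_mul, integral_complex_ofReal, integral_const_mul, h1, integral_div,
    tiltedCharFun]
  have e1 : ∫ ω, ((s * Y ω : ℝ) : ℂ) ^ 2 ∂(μ.tilted (η * X ·))
      = s ^ 2 * iteratedDeriv 2 (cgf X μ) η := by
    rw [← h2, ← ofReal_pow, ← ofReal_mul, ← integral_const_mul, ← integral_complex_ofReal]
    congr 1; ext ω; push_cast; ring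
  rw [e1]
  have e2 : ∀ ω, I * (s : ℂ) * ((X ω - deriv (cgf X μ) η : ℝ) : ℂ) = I * ((s * Y ω : ℝ) : ℂ) := by
    intro ω; simp only [hY]; push_cast; ring
  simp_rw [e2]
  simp

lemma norm_tiltedCharFun_sub_taylor_le (η s : ℝ) :
    ‖tiltedCharFun X μ η s - 1 + s ^ 2 * iteratedDeriv 2 (cgf X μ) η / 2‖
      ≤ 4 * s ^ 2 * iteratedDeriv 2 (cgf X μ) η := by
  rw [tiltedCharFun_sub_taylor_eq h, ← integral_tilted_sub_sq h, ← integral_const_mul]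
  refine norm_integral_le_of_norm_le ((memLp_tilted_sub h η 2).integrable_sq.const_mul _)
    (Eventually.of_forall fun ω => ?_)
  refine (norm_cexp_I_mul_sub_taylor_le _).1.trans_eq (by ring)

/-- Since `|y|³ ≤ 6 (e^y + e^{-y})`, the moment is bounded by an expression in `mgf (η ± 1) / mgf
η`, continuous in `η` and so bounded on compacts. -/
lemma exists_integral_abs_cube_tilted_le (B : ℝ) : ∃ C, 0 ≤ C ∧ ∀ η : ℝ, |η| ≤ B →
    ∫ ω, |X ω - deriv (cgf X μ) η| ^ 3 ∂(μ.tilted (η * X ·)) ≤ C := by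
  set g : ℝ → ℝ := fun η => 6 * (mgf X μ (η + 1) / mgf X μ η * Real.exp (-deriv (cgf X μ) η) +
    mgf X μ (η - 1) / mgf X μ η * Real.exp (deriv (cgf X μ) η)) with hg
  have hgc : Continuous g := by
    have h2 : Continuous (mgf X μ) := continuous_mgf h
    have h3 := continuous_deriv_cgf h
    have h4 : ∀ η : ℝ, mgf X μ η ≠ 0 := fun p => (mgf_pos (h p)).ne'
    fun_prop (disch := assumption)
  obtain ⟨C, hC⟩ := (isCompact_Icc (a := -B) (b := B)).exists_bound_of_continuousOn hgc.continuousOn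
  refine ⟨max C 0, le_max_right _ _, fun η hη => le_trans ?_ (((Real.le_norm_self _).trans
    (hC η (abs_le.1 hη))).trans (le_max_left _ _))⟩
  have hint (r : ℝ) : Integrable (fun ω => Real.exp (r * X ω)) (μ.tilted (η * X ·)) := by
    rw [integrable_tilted_iff (h η)]
    refine (h (η + r)).congr (Eventually.of_forall fun ω => ?_)
    simp only [smul_eq_mul]
    rw [← Real.exp_add]; congr 1; ring
  have hval (r : ℝ) : ∫ ω, Real.exp (r * X ω) ∂(μ.tilted (η * X ·))
      = mgf X μ (η + r) / mgf X μ η := by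
    rw [integral_tilted_mul_eq_mgf,
      show mgf X μ (η + r) = ∫ ω, Real.exp ((η + r) * X ω) ∂μ from rfl, ← integral_div]
    congr 1; ext ω
    rw [smul_eq_mul, div_mul_eq_mul_div, ← Real.exp_add]; congr 2; ring
  have e1 : g η = ∫ ω, 6 * (Real.exp (1 * X ω) * Real.exp (-deriv (cgf X μ) η) +
      Real.exp (-1 * X ω) * Real.exp (deriv (cgf X μ) η)) ∂(μ.tilted (η * X ·)) := by
    rw [integral_const_mul, integral_add ((hint 1).mul_const _) ((hint (-1)).mul_const _),
      integral_mul_const, integral_mul_const, hval, hval]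
    rfl
  rw [e1]
  refine integral_mono_of_nonneg (Eventually.of_forall fun ω => by positivity)
    ((((hint 1).mul_const _).add ((hint (-1)).mul_const _)).const_mul 6)
    (Eventually.of_forall fun ω => ?_)
  simp only
  rw [← Real.exp_add, ← Real.exp_add]
  set y := X ω - deriv (cgf X μ) η
  have h1 := Real.pow_div_factorial_le_exp |y| (abs_nonneg y) 3
  have h2 : Real.exp |y| ≤ Real.exp y + Real.exp (-y) := by
    rcases abs_choice y with h | h <;> rw [h] <;> linarith [Real.exp_pos y, Real.exp_pos (-y)]
  rw [show 1 * X ω + -deriv (cgf X μ) η = y by simp [y]; ring,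
    show -1 * X ω + deriv (cgf X μ) η = -y by simp [y]; ring]
  norm_num [Nat.factorial] at h1
  linarith

lemma exists_norm_tiltedCharFun_sub_taylor_le_cube (B : ℝ) :
    ∃ C, 0 ≤ C ∧ ∀ η : ℝ, |η| ≤ B → ∀ s : ℝ,
      ‖tiltedCharFun X μ η s - 1 + s ^ 2 * iteratedDeriv 2 (cgf X μ) η / 2‖ ≤ C * |s| ^ 3 := by
  obtain ⟨C, hC0, hC⟩ := exists_integral_abs_cube_tilted_le h B
  refine ⟨4 * C, by positivity, fun η hη s => ?_⟩
  have hi : Integrable (fun ω => |X ω - deriv (cgf X μ) η| ^ 3) (μ.tilted (η * X ·)) := by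
    have := (memLp_tilted_sub h η 3).integrable_norm_pow (by norm_num)
    simpa using this
  rw [tiltedCharFun_sub_taylor_eq h]
  calc _ ≤ ∫ ω, 4 * |s| ^ 3 * |X ω - deriv (cgf X μ) η| ^ 3 ∂(μ.tilted (η * X ·)) := by
        refine norm_integral_le_of_norm_le (hi.const_mul _) (Eventually.of_forall fun ω => ?_)
        refine (norm_cexp_I_mul_sub_taylor_le _).2.trans_eq ?_
        rw [abs_mul]; ring
    _ ≤ 4 * |s| ^ 3 * C := by
        rw [integral_const_mul]; gcongr; exact hC η hη
    _ = _ := by ring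

/-- The equality case of the triangle inequality: after rotation by the argument, a cosine has mean
`1`, so it equals `1` almost surely and `s X` lies in a coset of `2π ℤ`. -/
lemma norm_tiltedCharFun_lt_one {s : ℝ} (hs : ¬ ArithmeticAt X μ s) (η : ℝ) :
    ‖tiltedCharFun X μ η s‖ < 1 := by
  have := isProbabilityMeasure_tilted_mul h η
  refine lt_of_le_of_ne (norm_tiltedCharFun_le_one h η s) fun h1 => hs ?_
  set m := deriv (cgf X μ) η
  set z := tiltedCharFun X μ η s with hz
  have hz' : z = cexp (arg z * I) := by
    have := norm_mul_exp_arg_mul_I z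
    rw [h1] at this; simpa using this.symm
  have hme : AEStronglyMeasurable X (μ.tilted (η * X ·)) :=
    (memLp_tilted_mul (mem_interior_integrableExpSet_of_forall h η) 1).aestronglyMeasurable
  have hcexp : Integrable (fun ω => cexp (I * s * (X ω - m : ℝ))) (μ.tilted (η * X ·)) := by
    refine Integrable.of_bound (C := 1) ?_ (Eventually.of_forall fun ω => (norm_cexp_I_mul _ _).le)
    have : Continuous fun y : ℝ => cexp (I * s * (y - m : ℝ)) := by fun_prop
    exact this.comp_aestronglyMeasurable hme
  have h2 : ∫ ω, cexp (I * s * (X ω - m : ℝ)) * cexp (-(arg z * I)) ∂(μ.tilted (η * X ·)) = 1 := by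
    rw [integral_mul_const]
    change z * _ = 1
    nth_rewrite 1 [hz']
    rw [← Complex.exp_add]; simp
  have hre : ∀ ω, (cexp (I * s * (X ω - m : ℝ)) * cexp (-(arg z * I))).re
      = Real.cos (s * (X ω - m) - arg z) := by
    intro ω
    rw [← Complex.exp_add, show I * s * ((X ω - m : ℝ) : ℂ) + -(arg z * I)
      = ((s * (X ω - m) - arg z : ℝ) : ℂ) * I by push_cast; ring, exp_ofReal_mul_I_re]
  have h3 : ∫ ω, Real.cos (s * (X ω - m) - arg z) ∂(μ.tilted (η * X ·)) = 1 := by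
    have := congrArg Complex.re h2
    rw [one_re] at this
    rw [← this]
    simp_rw [← hre]
    exact integral_re (hcexp.mul_const _)
  have hcos : Integrable (fun ω => Real.cos (s * (X ω - m) - arg z)) (μ.tilted (η * X ·)) := by
    simp_rw [← hre]; exact (hcexp.mul_const _).re
  have h4 : ∫ ω, (1 - Real.cos (s * (X ω - m) - arg z)) ∂(μ.tilted (η * X ·)) = 0 := by
    rw [integral_sub (integrable_const _) hcos, h3]; simp
  rw [integral_eq_zero_iff_of_nonneg (fun ω => sub_nonneg.2 (Real.cos_le_one _))
    ((integrable_const _).sub hcos)] at h4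
  refine ⟨s * m + arg z, ?_⟩
  filter_upwards [(absolutelyContinuous_tilted (h η)).ae_le h4] with ω hω
  simp only [Pi.zero_apply, sub_eq_zero] at hω
  obtain ⟨k, hk⟩ := (Real.cos_eq_one_iff _).1 hω.symm
  exact ⟨k, by linarith⟩

end Tilted

/-! ### Bounds on a single factor -/

section Factor

variable {X : Ω → ℝ} {μ : Measure Ω} [IsProbabilityMeasure μ]
  (h : ∀ t : ℝ, Integrable (fun ω => Real.exp (t * X ω)) μ)

include h

lemma exists_bounds_iteratedDeriv_two_cgf (hX : ¬ ∃ c : ℝ, ∀ᵐ ω ∂μ, X ω = c) (B : ℝ) :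
    ∃ v₀ v₁ : ℝ, 0 < v₀ ∧ 0 < v₁ ∧ ∀ η : ℝ, |η| ≤ B →
      v₀ ≤ iteratedDeriv 2 (cgf X μ) η ∧ iteratedDeriv 2 (cgf X μ) η ≤ v₁ := by
  have hc := continuous_iteratedDeriv_two_cgf h
  have hpos := iteratedDeriv_two_cgf_pos h hX
  rcases lt_or_ge B 0 with hB | hB
  · exact ⟨1, 1, one_pos, one_pos, fun η hη => absurd ((abs_nonneg η).trans hη) (not_le.2 hB)⟩
  have hne : (Set.Icc (-B) B).Nonempty := ⟨0, by constructor <;> linarith⟩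
  obtain ⟨x, -, hx⟩ := isCompact_Icc.exists_isMinOn hne hc.continuousOn
  obtain ⟨y, -, hy⟩ := isCompact_Icc.exists_isMaxOn hne hc.continuousOn
  exact ⟨_, _, hpos x, hpos y, fun η hη => ⟨hx (abs_le.1 hη), hy (abs_le.1 hη)⟩⟩

lemma exists_norm_tiltedCharFun_le_exp (hX : ¬ ∃ c : ℝ, ∀ᵐ ω ∂μ, X ω = c) (B : ℝ) :
    ∃ δ > 0, ∃ c > 0, ∀ η : ℝ, |η| ≤ B → ∀ s : ℝ, |s| ≤ δ →
      ‖tiltedCharFun X μ η s‖ ≤ Real.exp (-c * s ^ 2) := by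
  obtain ⟨v₀, v₁, hv₀, hv₁, hv⟩ := exists_bounds_iteratedDeriv_two_cgf h hX B
  obtain ⟨C, hC0, hC⟩ := exists_norm_tiltedCharFun_sub_taylor_le_cube h B
  -- The first bound on `|s|` keeps `1 - s² v / 2` nonnegative; the second makes the cubic error at
  -- most half of the gain `v₀ s² / 2`.
  refine ⟨min (1 / (1 + v₁)) (v₀ / (4 * (C + 1))), by positivity, v₀ / 4, by positivity,
    fun η hη s hs => ?_⟩
  have hs1 : |s| * (1 + v₁) ≤ 1 := by
    have := hs.trans (min_le_left _ _)
    rwa [le_div_iff₀ (by positivity)] at this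
  have hs2 : |s| * (4 * (C + 1)) ≤ v₀ := by
    have := hs.trans (min_le_right _ _)
    rwa [le_div_iff₀ (by positivity)] at this
  obtain ⟨h0, h1⟩ := hv η hη
  set v := iteratedDeriv 2 (cgf X μ) η
  have habs := abs_nonneg s
  have hsq := sq_abs s
  have h2 : s ^ 2 * v / 2 ≤ 1 := by
    have hs1' : |s| ≤ 1 := by nlinarith
    have h4 : |s| * v₁ ≤ 1 := by nlinarith
    have : |s| ^ 2 * v ≤ 1 := by
      calc |s| ^ 2 * v ≤ |s| ^ 2 * v₁ := by gcongr
        _ = |s| * (|s| * v₁) := by ring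
        _ ≤ 1 := by nlinarith
    rw [← hsq]; linarith
  have h3 : ‖tiltedCharFun X μ η s‖ ≤ C * |s| ^ 3 + (1 - s ^ 2 * v / 2) := by
    have e : tiltedCharFun X μ η s = (tiltedCharFun X μ η s - 1 + s ^ 2 * v / 2)
      + ((1 - s ^ 2 * v / 2 : ℝ) : ℂ) := by push_cast; ring
    rw [e]
    refine (norm_add_le _ _).trans (add_le_add (hC η hη s) ?_)
    rw [Complex.norm_of_nonneg (by linarith)]
  have h4 : C * |s| ^ 3 ≤ v₀ / 4 * s ^ 2 := by
    rw [← hsq]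
    have : |s| * C ≤ v₀ / 4 := by nlinarith
    calc C * |s| ^ 3 = (|s| * C) * |s| ^ 2 := by ring
      _ ≤ _ := by gcongr
  have h5 : v₀ * s ^ 2 ≤ s ^ 2 * v := by nlinarith [sq_nonneg s]
  have h6 := Real.add_one_le_exp (-(v₀ / 4) * s ^ 2)
  linarith

/-- The local input for covering `[-T, T]`. At `t₀ = 0` it is the Gaussian bound near the origin.
Elsewhere the modulus is below some `ρ < 1` uniformly in `θ` by compactness, and this persists for
`(w, t)` near `(w₀, t₀)`. -/
lemma exists_norm_tiltedCharFun_mul_le_exp (hX : ¬ ∃ c : ℝ, ∀ᵐ ω ∂μ, X ω = c) (ϑs : ℝ)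
    {w₀ t₀ : ℝ} (hw₀ : w₀ ≠ 0) (ht₀ : t₀ ≠ 0 → ¬ ArithmeticAt X μ (w₀ * t₀)) :
    ∃ r > 0, ∃ c > 0, ∃ V ∈ 𝓝 t₀, ∀ w, |w - w₀| < r → ∀ θ ∈ Set.Icc 0 ϑs, ∀ t ∈ V,
      ‖tiltedCharFun X μ (θ * w) (w * t)‖ ≤ Real.exp (-c * t ^ 2) := by
  by_cases h0 : t₀ = 0
  · subst h0
    obtain ⟨δ, hδ, c, hc, hb⟩ := exists_norm_tiltedCharFun_le_exp h hX (ϑs * (2 * |w₀|))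
    have hw : 0 < |w₀| := abs_pos.2 hw₀
    refine ⟨|w₀| / 2, by positivity, c * (|w₀| / 2) ^ 2, by positivity,
      Metric.ball 0 (δ / (2 * |w₀|)), Metric.ball_mem_nhds _ (by positivity),
      fun w hwr θ hθ t ht => ?_⟩
    have hlo : |w₀| / 2 ≤ |w| := by
      have := abs_sub_abs_le_abs_sub w₀ w
      rw [abs_sub_comm] at this; linarith
    have hhi : |w| ≤ 2 * |w₀| := by
      have := abs_sub_abs_le_abs_sub w w₀
      linarith
    rw [Metric.mem_ball, Real.dist_eq, sub_zero, lt_div_iff₀ (by positivity)] at ht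
    refine (hb _ ?_ _ ?_).trans (Real.exp_le_exp.2 ?_)
    · rw [abs_mul, abs_of_nonneg hθ.1]
      exact mul_le_mul hθ.2 hhi (abs_nonneg _) (hθ.1.trans hθ.2)
    · rw [abs_mul]
      calc |w| * |t| ≤ 2 * |w₀| * |t| := by gcongr
        _ ≤ δ := by linarith
    · have : (|w₀| / 2) ^ 2 ≤ w ^ 2 := by rw [← sq_abs w]; gcongr
      have : (|w₀| / 2) ^ 2 * (c * t ^ 2) ≤ w ^ 2 * (c * t ^ 2) := by gcongr
      nlinarith
  · have hcont : Continuous fun p : (ℝ × ℝ) × ℝ =>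
        ‖tiltedCharFun X μ (p.2 * p.1.1) (p.1.1 * p.1.2)‖ :=
      ((continuous_tiltedCharFun h).comp
        (f := fun p : (ℝ × ℝ) × ℝ => (p.2 * p.1.1, p.1.1 * p.1.2)) (by fun_prop)).norm
    obtain ⟨ρ, hρ0, hρ1, hρ⟩ : ∃ ρ : ℝ, 0 < ρ ∧ ρ < 1 ∧ ∀ θ ∈ Set.Icc 0 ϑs,
        ‖tiltedCharFun X μ (θ * w₀) (w₀ * t₀)‖ < ρ := by
      rcases (Set.Icc 0 ϑs).eq_empty_or_nonempty with he | hne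
      · exact ⟨1 / 2, by norm_num, by norm_num, by simp [he]⟩
      · have hc1 : Continuous fun θ : ℝ => ‖tiltedCharFun X μ (θ * w₀) (w₀ * t₀)‖ :=
          hcont.comp (f := fun θ : ℝ => ((w₀, t₀), θ)) (by fun_prop)
        obtain ⟨x, -, hx⟩ := isCompact_Icc.exists_isMaxOn hne hc1.continuousOn
        have hlt := norm_tiltedCharFun_lt_one h (ht₀ h0) (x * w₀)
        have hnn := norm_nonneg (tiltedCharFun X μ (x * w₀) (w₀ * t₀))
        refine ⟨(‖tiltedCharFun X μ (x * w₀) (w₀ * t₀)‖ + 1) / 2, by linarith, by linarith,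
          fun θ hθ => ?_⟩
        have : ‖tiltedCharFun X μ (θ * w₀) (w₀ * t₀)‖ ≤ ‖tiltedCharFun X μ (x * w₀) (w₀ * t₀)‖ :=
          hx hθ
        linarith
    have hev : ∀ᶠ p : ℝ × ℝ in 𝓝 (w₀, t₀), ∀ θ ∈ Set.Icc 0 ϑs,
        ‖tiltedCharFun X μ (θ * p.1) (p.1 * p.2)‖ < ρ := by
      refine isCompact_Icc.eventually_forall_of_forall_eventually fun θ hθ => ?_
      exact (hcont.tendsto ((w₀, t₀), θ)).eventually (gt_mem_nhds (hρ θ hθ))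
    rw [nhds_prod_eq] at hev
    obtain ⟨U, hU, V, hV, hUV⟩ := eventually_prod_iff.1 hev
    obtain ⟨r, hr, hrU⟩ := Metric.eventually_nhds_iff.1 hU
    -- On the unit ball around `t₀` one has `|t| ≤ |t₀| + 1`, so this constant gives `ρ ≤ e^{-c
    -- t²}`.
    refine ⟨r, hr, -Real.log ρ / (|t₀| + 1) ^ 2, div_pos (neg_pos.2 (Real.log_neg hρ0 hρ1))
      (by positivity), {t | V t} ∩ Metric.ball t₀ 1,
      inter_mem hV (Metric.ball_mem_nhds _ one_pos), fun w hw θ hθ t ht => ?_⟩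
    refine (hUV (hrU hw) ht.1 θ hθ).le.trans ?_
    have hρ' : ρ = Real.exp (Real.log ρ) := (Real.exp_log hρ0).symm
    have hlog := Real.log_neg hρ0 hρ1
    have htb : |t| ≤ |t₀| + 1 := by
      have h1 := abs_sub_abs_le_abs_sub t t₀
      have h2 := ht.2
      rw [Metric.mem_ball, Real.dist_eq] at h2
      linarith
    have h2 : t ^ 2 ≤ (|t₀| + 1) ^ 2 := by rw [← sq_abs]; gcongr
    conv_lhs => rw [hρ']
    refine Real.exp_le_exp.2 ?_
    have h3 : t ^ 2 / (|t₀| + 1) ^ 2 ≤ 1 := div_le_one_of_le₀ h2 (by positivity)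
    have : -(-Real.log ρ / (|t₀| + 1) ^ 2) * t ^ 2 = Real.log ρ * (t ^ 2 / (|t₀| + 1) ^ 2) := by ring
    rw [this]
    nlinarith

end Factor

/-! ### The tilted law of a weighted sum -/

section WeightedSum

variable {μ : Measure Ω} {Z : ℕ → Ω → ℝ}

variable (Z) in
/-- The sum `∑_{j < n} w_j Z_j` with deterministic weights. -/
def detSum (w : ℕ → ℝ) (n : ℕ) (ω : Ω) : ℝ := ∑ j ∈ Finset.range n, w j * Z j ω

lemma measurable_detSum (hZm : ∀ j, Measurable (Z j)) (w : ℕ → ℝ) (n : ℕ) :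
    Measurable (detSum Z w n) := by unfold detSum; fun_prop

variable (μ Z) in
/-- The law of `S_n - a n` under the exponential tilt by `θ S_n`. -/
def tiltedLaw (w : ℕ → ℝ) (a : ℝ) (n : ℕ) (θ : ℝ) : Measure ℝ :=
  (μ.tilted (θ * detSum Z w n ·)).map fun ω => detSum Z w n ω - a * n

variable (hZm : ∀ j, Measurable (Z j)) (hZindep : iIndepFun Z μ)
  (hZid : ∀ j, IdentDistrib (Z j) (Z 0) μ μ)

include hZm hZindep hZid

lemma complexMGF_detSum (w : ℕ → ℝ) (n : ℕ) (z : ℂ) :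
    complexMGF (detSum Z w n) μ z = ∏ j ∈ Finset.range n, complexMGF (Z 0) μ (z * w j) := by
  have hf : ∀ j : Fin n, Measurable fun x : ℝ => cexp (z * (w j * x : ℝ)) := fun j => by fun_prop
  have hi : iIndepFun (fun j : Fin n => Z j) μ := hZindep.precomp Fin.val_injective
  have h2 := (hi.comp (fun j x => cexp (z * (w j * x : ℝ))) hf).integral_fun_prod_eq_prod_integral
    (fun j => ((hf j).comp (hZm j)).aestronglyMeasurable)
  rw [complexMGF, Finset.prod_range]
  have h3 : ∀ ω, cexp (z * (detSum Z w n ω : ℝ))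
      = ∏ j : Fin n, ((fun x : ℝ => cexp (z * (w j * x : ℝ))) ∘ Z j) ω := by
    intro ω
    simp only [Function.comp_apply]
    rw [← Complex.exp_sum, detSum, Finset.sum_range, ← Finset.mul_sum]
    push_cast; rfl
  simp_rw [h3]
  rw [h2]
  refine Finset.prod_congr rfl fun j _ => ?_
  rw [← complexMGF_congr_identDistrib (hZid j), complexMGF]
  congr 1; ext ω
  simp only [Function.comp_apply]
  congr 1; push_cast; ring

lemma mgf_detSum (w : ℕ → ℝ) (n : ℕ) (θ : ℝ) :
    mgf (detSum Z w n) μ θ = ∏ j ∈ Finset.range n, mgf (Z 0) μ (θ * w j) := by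
  have := complexMGF_detSum hZm hZindep hZid w n θ
  rw [complexMGF_ofReal] at this
  have h2 : ∀ j, complexMGF (Z 0) μ (θ * w j) = mgf (Z 0) μ (θ * w j) := fun j => by
    rw [← ofReal_mul, complexMGF_ofReal]
  simp_rw [h2] at this
  exact_mod_cast this

/-- The saddle point equation `ha` distributes the centring `a n` over the summands, so that each
factor is centred at its own tilted mean. -/
lemma charFun_tiltedLaw (w : ℕ → ℝ) {a : ℝ} {n : ℕ} {θ : ℝ}
    (ha : ∑ j ∈ Finset.range n, w j * deriv (cgf (Z 0) μ) (θ * w j) = a * n) (t : ℝ) :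
    charFun (tiltedLaw μ Z w a n θ) t
      = ∏ j ∈ Finset.range n, tiltedCharFun (Z 0) μ (θ * w j) (w j * t) := by
  have hm := measurable_detSum hZm w n
  have h1 : charFun (tiltedLaw μ Z w a n θ) t
      = complexMGF (detSum Z w n) μ (θ + t * I) / mgf (detSum Z w n) μ θ * cexp (-(I * t * (a * n : ℝ))) := by
    rw [charFun_apply_real, tiltedLaw, integral_map (hm.sub_const _).aemeasurable
      (Continuous.aestronglyMeasurable (by fun_prop)), integral_tilted_mul_eq_mgf, complexMGF,
      ← integral_div, ← integral_mul_const]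
    congr 1; ext ω
    rw [real_smul, ofReal_div, ofReal_exp, div_mul_eq_mul_div, div_mul_eq_mul_div,
      ← Complex.exp_add, ← Complex.exp_add]
    congr 2; push_cast; ring
  rw [h1, complexMGF_detSum hZm hZindep hZid, mgf_detSum hZm hZindep hZid, ← ha]
  simp_rw [tiltedCharFun_eq]
  push_cast
  rw [Finset.prod_mul_distrib, Finset.prod_div_distrib, ← Complex.exp_sum, Finset.mul_sum,
    Finset.sum_neg_distrib]
  congr 1
  · congr 1
    refine Finset.prod_congr rfl fun j _ => ?_
    congr 1; ring
  · congr 2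
    refine Finset.sum_congr rfl fun j _ => ?_
    ring

variable [IsProbabilityMeasure μ] (h : ∀ t : ℝ, Integrable (fun ω => Real.exp (t * Z 0 ω)) μ)

include h

/-- Without integrability `mgf` would take its default value `0`, whereas the product formula makes
it positive. -/
lemma integrable_exp_mul_detSum (w : ℕ → ℝ) (n : ℕ) (θ : ℝ) :
    Integrable (fun ω => Real.exp (θ * detSum Z w n ω)) μ := by
  by_contra hcon
  have h1 := mgf_detSum hZm hZindep hZid w n θ
  rw [mgf_undef hcon] at h1
  exact (Finset.prod_pos fun j _ => mgf_pos (h (θ * w j))).ne h1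

lemma isProbabilityMeasure_tiltedLaw (w : ℕ → ℝ) (a : ℝ) (n : ℕ) (θ : ℝ) :
    IsProbabilityMeasure (tiltedLaw μ Z w a n θ) := by
  have := isProbabilityMeasure_tilted_mul (integrable_exp_mul_detSum hZm hZindep hZid h w n) θ
  exact Measure.isProbabilityMeasure_map
    ((measurable_detSum hZm w n).sub_const _).aemeasurable

end WeightedSum

/-! ### The local limit theorem for a fixed sequence of weights -/

/-- The variance of `∑_{j < n} w_j Z_j` under the exponential tilt with parameter `θ`, in terms of
the cumulant generating function `f` of the `Z_j`. -/
def tiltedVar (f : ℝ → ℝ) (w : ℕ → ℝ) (n : ℕ) (θ : ℝ) : ℝ :=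
  ∑ j ∈ Finset.range n, w j ^ 2 * iteratedDeriv 2 f (θ * w j)

/-- Regularity of a sequence of weights: the variances are uniformly integrable along the sequence,
and for every frequency `t₀` a positive proportion of the weights is close to some `w₀ ≠ 0` such
that `w₀ t₀ X` is not arithmetic. -/
structure RegularWeights (X : Ω → ℝ) (μ : Measure Ω) (ϑs : ℝ) (G : ℝ → ℝ) (w : ℕ → ℝ) : Prop where
  var_le : ∀ j, ∀ ϑ ∈ Set.Icc 0 ϑs, w j ^ 2 * iteratedDeriv 2 (cgf X μ) (ϑ * w j) ≤ G (w j)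
  sum_le : ∃ C > 0, ∀ᶠ n : ℕ in atTop, ∑ j ∈ Finset.range n, G (w j) ≤ C * n
  tail_le : ∀ ε > 0, ∃ K ≥ (0 : ℝ), ∀ᶠ n : ℕ in atTop,
    ∑ j ∈ Finset.range n, (if K < |w j| then G (w j) else 0) ≤ ε * n
  spread : ∀ t₀ : ℝ, ∃ w₀ : ℝ, w₀ ≠ 0 ∧ (t₀ ≠ 0 → ¬ ArithmeticAt X μ (w₀ * t₀)) ∧
    ∀ r > 0, ∃ p > 0, ∀ᶠ n : ℕ in atTop,
      p * n ≤ ∑ j ∈ Finset.range n, if |w j - w₀| < r then (1 : ℝ) else 0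

lemma norm_prod_sub_prod_le {ι : Type*} (s : Finset ι) (u v : ι → ℂ) (hu : ∀ i ∈ s, ‖u i‖ ≤ 1)
    (hv : ∀ i ∈ s, ‖v i‖ ≤ 1) : ‖∏ i ∈ s, u i - ∏ i ∈ s, v i‖ ≤ ∑ i ∈ s, ‖u i - v i‖ := by
  classical
  induction s using Finset.induction_on with
  | empty => simp
  | insert a s ha ih =>
    rw [Finset.prod_insert ha, Finset.prod_insert ha, Finset.sum_insert ha]
    have h1 := ih (fun i hi => hu i (Finset.mem_insert_of_mem hi))
      (fun i hi => hv i (Finset.mem_insert_of_mem hi))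
    have h2 : ‖∏ i ∈ s, v i‖ ≤ 1 := by
      rw [norm_prod]
      exact Finset.prod_le_one (fun _ _ => norm_nonneg _)
        fun i hi => hv i (Finset.mem_insert_of_mem hi)
    have h3 := hu a (Finset.mem_insert_self a s)
    have e : u a * ∏ i ∈ s, u i - v a * ∏ i ∈ s, v i
        = u a * (∏ i ∈ s, u i - ∏ i ∈ s, v i) + (u a - v a) * ∏ i ∈ s, v i := by ring
    rw [e]
    calc _ ≤ ‖u a‖ * ‖∏ i ∈ s, u i - ∏ i ∈ s, v i‖ + ‖u a - v a‖ * ‖∏ i ∈ s, v i‖ := by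
          rw [← norm_mul, ← norm_mul]; exact norm_add_le _ _
      _ ≤ 1 * ‖∏ i ∈ s, u i - ∏ i ∈ s, v i‖ + ‖u a - v a‖ * 1 := by gcongr
      _ ≤ _ := by linarith

/-- As for `e^{iy}`: the linear bound serves large weights, the quadratic one bounded weights. -/
lemma abs_exp_neg_sub_le {y : ℝ} (hy : 0 ≤ y) :
    |Real.exp (-y) - (1 - y)| ≤ y ∧ |Real.exp (-y) - (1 - y)| ≤ y ^ 2 := by
  have h0 := Real.add_one_le_exp (-y)
  have h1 : Real.exp (-y) ≤ 1 := Real.exp_le_one_iff.2 (by linarith)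
  have h2 : |Real.exp (-y) - (1 - y)| ≤ y := by rw [abs_le]; constructor <;> linarith
  refine ⟨h2, ?_⟩
  rcases le_total y 1 with h | h
  · have := Real.abs_exp_sub_one_sub_id_le (x := -y) (by rwa [abs_neg, abs_of_nonneg hy])
    rw [neg_sq] at this
    rwa [show Real.exp (-y) - (1 - y) = Real.exp (-y) - 1 - -y by ring]
  · exact h2.trans (by nlinarith)

lemma RegularWeights.exists_tiltedVar_le {X : Ω → ℝ} {μ : Measure Ω} {ϑs : ℝ} {G : ℝ → ℝ}
    {w : ℕ → ℝ} (hw : RegularWeights X μ ϑs G w) :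
    ∃ C > 0, ∀ᶠ n : ℕ in atTop, ∀ θ ∈ Set.Icc 0 ϑs, tiltedVar (cgf X μ) w n θ ≤ C * n := by
  obtain ⟨C, hC, hCn⟩ := hw.sum_le
  refine ⟨C, hC, hCn.mono fun n hn θ hθ => le_trans ?_ hn⟩
  exact Finset.sum_le_sum fun j _ => hw.var_le j θ hθ

lemma tiltedVar_nonneg {X : Ω → ℝ} {μ : Measure Ω}
    (h : ∀ t : ℝ, Integrable (fun ω => Real.exp (t * X ω)) μ) (w : ℕ → ℝ) (n : ℕ) (θ : ℝ) :
    0 ≤ tiltedVar (cgf X μ) w n θ :=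
  Finset.sum_nonneg fun _ _ => mul_nonneg (sq_nonneg _) (iteratedDeriv_two_cgf_nonneg h _)

section Deterministic

variable {μ : Measure Ω} [IsProbabilityMeasure μ] {X : Ω → ℝ}
  (h : ∀ t : ℝ, Integrable (fun ω => Real.exp (t * X ω)) μ)
  (hX : ¬ ∃ c : ℝ, ∀ᵐ ω ∂μ, X ω = c)
  {ϑs : ℝ} {G : ℝ → ℝ} {w : ℕ → ℝ} (hw : RegularWeights X μ ϑs G w)

include h hw

include hX in
-- A positive proportion of the weights has modulus between `|w₀| / 2` and `2 |w₀|`, where the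
-- tilted variance of a single term is bounded below uniformly in `θ`.
lemma RegularWeights.exists_le_tiltedVar :
    ∃ c > 0, ∀ᶠ n : ℕ in atTop, ∀ θ ∈ Set.Icc 0 ϑs, c * n ≤ tiltedVar (cgf X μ) w n θ := by
  obtain ⟨w₀, hw₀, -, hp⟩ := hw.spread 0
  have hwp : 0 < |w₀| := abs_pos.2 hw₀
  obtain ⟨p, hp0, hpn⟩ := hp (|w₀| / 2) (by positivity)
  obtain ⟨v₀, v₁, hv₀, hv₁, hv⟩ := exists_bounds_iteratedDeriv_two_cgf h hX (ϑs * (2 * |w₀|))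
  refine ⟨(|w₀| / 2) ^ 2 * v₀ * p, by positivity, hpn.mono fun n hn θ hθ => ?_⟩
  calc (|w₀| / 2) ^ 2 * v₀ * p * n = (|w₀| / 2) ^ 2 * v₀ * (p * n) := by ring
    _ ≤ (|w₀| / 2) ^ 2 * v₀ * ∑ j ∈ Finset.range n,
        (if |w j - w₀| < |w₀| / 2 then (1 : ℝ) else 0) := by gcongr
    _ ≤ _ := by
      rw [Finset.mul_sum]
      refine Finset.sum_le_sum fun j _ => ?_
      split_ifs with hj
      · have hlo : |w₀| / 2 ≤ |w j| := by
          have := abs_sub_abs_le_abs_sub w₀ (w j)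
          rw [abs_sub_comm] at this; linarith
        have hhi : |w j| ≤ 2 * |w₀| := by
          have := abs_sub_abs_le_abs_sub (w j) w₀
          linarith
        have h1 : |θ * w j| ≤ ϑs * (2 * |w₀|) := by
          rw [abs_mul, abs_of_nonneg hθ.1]
          exact mul_le_mul hθ.2 hhi (abs_nonneg _) (hθ.1.trans hθ.2)
        rw [mul_one, ← sq_abs (w j)]
        have := (hv _ h1).1
        gcongr
      · rw [mul_zero]
        exact mul_nonneg (sq_nonneg _) (iteratedDeriv_two_cgf_nonneg h _)

include hX in
-- Compactness reduces the bound to a neighbourhood of each `t₀`. There the proportion `p` of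
-- factors with weight near `w₀` contributes `e^{-c t²}` each, and the others at most `1`.
lemma RegularWeights.exists_norm_prod_le (T : ℝ) :
    ∃ c > 0, ∀ᶠ n : ℕ in atTop, ∀ t ∈ Set.Icc (-T) T, ∀ θ ∈ Set.Icc 0 ϑs,
      ‖∏ j ∈ Finset.range n, tiltedCharFun X μ (θ * w j) (w j * t)‖ ≤ Real.exp (-c * n * t ^ 2) := by
  refine isCompact_Icc.induction_on (p := fun V => ∃ c > 0, ∀ᶠ n : ℕ in atTop, ∀ t ∈ V,
    ∀ θ ∈ Set.Icc 0 ϑs, ‖∏ j ∈ Finset.range n, tiltedCharFun X μ (θ * w j) (w j * t)‖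
      ≤ Real.exp (-c * n * t ^ 2)) ?_ ?_ ?_ ?_
  · exact ⟨1, one_pos, by simp⟩
  · rintro s t hst ⟨c, hc, hn⟩
    exact ⟨c, hc, hn.mono fun n hn x hx => hn x (hst hx)⟩
  · rintro s t ⟨c, hc, hcn⟩ ⟨d, hd, hdn⟩
    refine ⟨min c d, lt_min hc hd, ?_⟩
    filter_upwards [hcn, hdn] with n h1 h2 x hx θ hθ
    rcases hx with hx | hx
    · refine (h1 x hx θ hθ).trans (Real.exp_le_exp.2 ?_)
      have : min c d * (n * x ^ 2) ≤ c * (n * x ^ 2) := by gcongr; exact min_le_left _ _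
      linarith
    · refine (h2 x hx θ hθ).trans (Real.exp_le_exp.2 ?_)
      have : min c d * (n * x ^ 2) ≤ d * (n * x ^ 2) := by gcongr; exact min_le_right _ _
      linarith
  · intro t₀ _
    obtain ⟨w₀, hw₀, har, hp⟩ := hw.spread t₀
    obtain ⟨r, hr, c, hc, V, hV, hb⟩ := exists_norm_tiltedCharFun_mul_le_exp h hX ϑs hw₀ har
    obtain ⟨p, hp0, hpn⟩ := hp r hr
    refine ⟨V, mem_nhdsWithin_of_mem_nhds hV, c * p, by positivity, hpn.mono fun n hn t ht θ hθ => ?_⟩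
    rw [norm_prod]
    calc _ ≤ ∏ j ∈ Finset.range n,
          Real.exp (-c * t ^ 2 * if |w j - w₀| < r then (1 : ℝ) else 0) := by
          refine Finset.prod_le_prod (fun _ _ => norm_nonneg _) fun j _ => ?_
          split_ifs with hj
          · rw [mul_one]; exact hb _ hj θ hθ t ht
          · simpa using norm_tiltedCharFun_le_one h _ _
      _ ≤ _ := by
          rw [← Real.exp_sum, ← Finset.mul_sum]
          refine Real.exp_le_exp.2 ?_
          have := mul_le_mul_of_nonneg_left hn (show 0 ≤ c * t ^ 2 by positivity)
          linarith

/-- Lindeberg's truncation at level `K`: a weight beyond `K` costs at most `5 t² G (w j)`, four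
parts from the characteristic function and one from the exponential, hence the `ε / 5`; any other
weight costs `O(|t|³)`. -/
lemma RegularWeights.exists_sum_norm_sub_le {ε : ℝ} (hε : 0 < ε) :
    ∃ C : ℝ, ∀ᶠ n : ℕ in atTop, ∀ θ ∈ Set.Icc 0 ϑs, ∀ t : ℝ, |t| ≤ 1 →
      ∑ j ∈ Finset.range n, ‖tiltedCharFun X μ (θ * w j) (w j * t) -
        (Real.exp (-(t ^ 2 * (w j ^ 2 * iteratedDeriv 2 (cgf X μ) (θ * w j)) / 2)) : ℝ)‖
      ≤ (ε * t ^ 2 + C * |t| ^ 3) * n := by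
  obtain ⟨K, hK0, hK⟩ := hw.tail_le (ε / 5) (by positivity)
  obtain ⟨C, hC0, hC⟩ := exists_norm_tiltedCharFun_sub_taylor_le_cube h (ϑs * K)
  obtain ⟨D, hD⟩ := (isCompact_Icc (a := -(ϑs * K)) (b := ϑs * K)).exists_bound_of_continuousOn
    (continuous_iteratedDeriv_two_cgf h).continuousOn
  refine ⟨C * K ^ 3 + (K ^ 2 * D / 2) ^ 2, hK.mono fun n hn θ hθ t ht => ?_⟩
  have key : ∀ j, ‖tiltedCharFun X μ (θ * w j) (w j * t) -
        (Real.exp (-(t ^ 2 * (w j ^ 2 * iteratedDeriv 2 (cgf X μ) (θ * w j)) / 2)) : ℝ)‖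
      ≤ 5 * t ^ 2 * (if K < |w j| then G (w j) else 0)
        + (C * K ^ 3 + (K ^ 2 * D / 2) ^ 2) * |t| ^ 3 := by
    intro j
    set v := iteratedDeriv 2 (cgf X μ) (θ * w j) with hv
    have hv0 : 0 ≤ v := iteratedDeriv_two_cgf_nonneg h _
    set y := t ^ 2 * (w j ^ 2 * v) / 2 with hy
    have hy0 : 0 ≤ y := by positivity
    have hsplit : ‖tiltedCharFun X μ (θ * w j) (w j * t) - (Real.exp (-y) : ℝ)‖ ≤
        ‖tiltedCharFun X μ (θ * w j) (w j * t) - 1 + ((w j * t : ℝ) : ℂ) ^ 2 * v / 2‖ +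
          |Real.exp (-y) - (1 - y)| := by
      rw [← Real.norm_eq_abs, ← Complex.norm_real]
      have e : tiltedCharFun X μ (θ * w j) (w j * t) - (Real.exp (-y) : ℝ)
        = (tiltedCharFun X μ (θ * w j) (w j * t) - 1 + ((w j * t : ℝ) : ℂ) ^ 2 * v / 2) -
          ((Real.exp (-y) - (1 - y) : ℝ) : ℂ) := by
        rw [hy]; push_cast; ring
      rw [e]; exact norm_sub_le _ _
    refine hsplit.trans ?_
    split_ifs with hj
    · have h1 := norm_tiltedCharFun_sub_taylor_le h (θ * w j) (w j * t)
      rw [← hv] at h1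
      have h2 := (abs_exp_neg_sub_le hy0).1
      have h3 : t ^ 2 * (w j ^ 2 * v) ≤ t ^ 2 * G (w j) := by
        have := hw.var_le j θ hθ
        gcongr
      have h5 : 0 ≤ (C * K ^ 3 + (K ^ 2 * D / 2) ^ 2) * |t| ^ 3 := by positivity
      have h6 : 4 * (w j * t) ^ 2 * v = 4 * (t ^ 2 * (w j ^ 2 * v)) := by ring
      have h7 : 0 ≤ t ^ 2 * (w j ^ 2 * v) := by positivity
      linarith
    · have hj' := not_lt.1 hj
      have hη : |θ * w j| ≤ ϑs * K := by
        rw [abs_mul, abs_of_nonneg hθ.1]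
        exact mul_le_mul hθ.2 hj' (abs_nonneg _) (hθ.1.trans hθ.2)
      have h1 := hC _ hη (w j * t)
      rw [← hv, abs_mul, mul_pow] at h1
      have h2 := (abs_exp_neg_sub_le hy0).2
      have hvD : v ≤ D := (Real.le_norm_self _).trans (hD _ (abs_le.1 hη))
      have h3 : y ≤ t ^ 2 * (K ^ 2 * D / 2) := by
        rw [hy]
        have : w j ^ 2 ≤ K ^ 2 := by rw [← sq_abs]; gcongr
        calc t ^ 2 * (w j ^ 2 * v) / 2 ≤ t ^ 2 * (K ^ 2 * D) / 2 := by gcongr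
          _ = _ := by ring
      have h4 : y ^ 2 ≤ |t| ^ 3 * (K ^ 2 * D / 2) ^ 2 := by
        calc y ^ 2 ≤ (t ^ 2 * (K ^ 2 * D / 2)) ^ 2 := by gcongr
          _ = |t| ^ 4 * (K ^ 2 * D / 2) ^ 2 := by rw [← sq_abs t]; ring
          _ ≤ _ := by
            gcongr ?_ * _
            exact pow_le_pow_of_le_one (abs_nonneg _) ht (by norm_num)
      have h5 : C * (|w j| ^ 3 * |t| ^ 3) ≤ C * (K ^ 3 * |t| ^ 3) := by gcongr
      linarith
  refine (Finset.sum_le_sum fun j _ => key j).trans ?_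
  rw [Finset.sum_add_distrib, ← Finset.mul_sum, Finset.sum_const, Finset.card_range, nsmul_eq_mul]
  have : 5 * t ^ 2 * ∑ j ∈ Finset.range n, (if K < |w j| then G (w j) else 0)
    ≤ 5 * t ^ 2 * (ε / 5 * n) := by gcongr
  linarith

include hX in
/-- The central limit theorem for the tilted characteristic functions. -/
lemma RegularWeights.tendsto_prod_tiltedCharFun {θ : ℕ → ℝ}
    (hθ : ∀ᶠ n in atTop, θ n ∈ Set.Icc 0 ϑs) (x : ℝ) :
    Tendsto (fun n => ∏ j ∈ Finset.range n, tiltedCharFun X μ (θ n * w j)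
      (w j * (x / √(tiltedVar (cgf X μ) w n (θ n))))) atTop
      (𝓝 (Real.exp (-(x ^ 2) / 2) : ℝ)) := by
  obtain ⟨c, hc, hcn⟩ := hw.exists_le_tiltedVar h hX
  set N : ℕ → ℝ := fun n => √(tiltedVar (cgf X μ) w n (θ n)) with hN
  have hNc : ∀ᶠ n : ℕ in atTop, c * n ≤ N n ^ 2 := by
    filter_upwards [hcn, hθ] with n h1 h2
    rw [hN, Real.sq_sqrt (tiltedVar_nonneg h _ _ _)]
    exact h1 _ h2
  have hNt : Tendsto N atTop atTop := by
    refine Real.tendsto_sqrt_atTop.comp (tendsto_atTop_mono' atTop ?_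
      (tendsto_natCast_atTop_atTop.const_mul_atTop hc))
    filter_upwards [hcn, hθ] with n h1 h2 using h1 _ h2
  have ht : Tendsto (fun n => |x / N n|) atTop (𝓝 0) := by
    simpa using (hNt.const_div_atTop x).abs
  rw [Metric.tendsto_nhds]
  intro δ hδ
  -- Since `(x / N n)² n ≤ x² / c`, this choice keeps the quadratic error below `δ / 2`.
  obtain ⟨C, hC⟩ := hw.exists_sum_norm_sub_le h (ε := δ / 2 / (x ^ 2 / c + 1)) (by positivity)
  have hlim : Tendsto (fun n => |C| * |x / N n| * (x ^ 2 / c)) atTop (𝓝 0) := by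
    simpa using (ht.const_mul |C|).mul_const (x ^ 2 / c)
  filter_upwards [hC, hθ, hNc, ht.eventually (gt_mem_nhds one_pos),
    hlim.eventually (gt_mem_nhds (half_pos hδ)), hNt.eventually_gt_atTop 0]
    with n h1 h2 h3 h4 h5 h6
  have h7 := h1 _ h2 _ h4.le
  -- The Gaussian factors have the variances of the summands, which add up to `N n ^ 2`; their
  -- product is therefore exactly the limit.
  have hprod : ∏ j ∈ Finset.range n, ((Real.exp (-((x / N n) ^ 2 * (w j ^ 2 *
      iteratedDeriv 2 (cgf X μ) (θ n * w j)) / 2)) : ℝ) : ℂ) = (Real.exp (-(x ^ 2) / 2) : ℝ) := by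
    rw [← ofReal_prod, ← Real.exp_sum]
    congr 2
    rw [Finset.sum_neg_distrib, ← Finset.sum_div, ← Finset.mul_sum]
    change -((x / N n) ^ 2 * tiltedVar (cgf X μ) w n (θ n) / 2) = _
    rw [← Real.sq_sqrt (tiltedVar_nonneg h w n (θ n))]
    change -((x / N n) ^ 2 * N n ^ 2 / 2) = _
    field_simp
  rw [dist_eq_norm, ← hprod]
  refine (norm_prod_sub_prod_le _ _ _ (fun j _ => norm_tiltedCharFun_le_one h _ _) fun j _ => ?_).trans_lt
    (h7.trans_lt ?_)
  · rw [Complex.norm_of_nonneg (Real.exp_nonneg _), Real.exp_le_one_iff, neg_nonpos]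
    have := iteratedDeriv_two_cgf_nonneg h (θ n * w j)
    positivity
  · have h8 : (x / N n) ^ 2 * n ≤ x ^ 2 / c := by
      rw [div_pow, div_mul_eq_mul_div, div_le_div_iff₀ (by positivity) hc]
      nlinarith [sq_nonneg x]
    have h9 : C * |x / N n| ^ 3 * n ≤ |C| * |x / N n| * (x ^ 2 / c) := by
      calc C * |x / N n| ^ 3 * n ≤ |C| * |x / N n| ^ 3 * n := by gcongr; exact le_abs_self C
        _ = |C| * |x / N n| * ((x / N n) ^ 2 * n) := by rw [← sq_abs (x / N n)]; ring
        _ ≤ _ := by gcongr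
    have h10 : δ / 2 / (x ^ 2 / c + 1) * (x / N n) ^ 2 * n ≤ δ / 2 := by
      calc _ = δ / 2 / (x ^ 2 / c + 1) * ((x / N n) ^ 2 * n) := by ring
        _ ≤ δ / 2 / (x ^ 2 / c + 1) * (x ^ 2 / c + 1) := by gcongr; linarith
        _ = δ / 2 := by field_simp
    linarith

omit h hw in
/-- The local limit theorem for the tilted weighted sums, in the form needed for exact
asymptotics. -/
theorem RegularWeights.tendsto_expTail_tiltedLaw {Z : ℕ → Ω → ℝ} (hZm : ∀ j, Measurable (Z j))
    (hZindep : iIndepFun Z μ) (hZid : ∀ j, IdentDistrib (Z j) (Z 0) μ μ)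
    (h : ∀ t : ℝ, Integrable (fun ω => Real.exp (t * Z 0 ω)) μ)
    (hX : ¬ ∃ c : ℝ, ∀ᵐ ω ∂μ, Z 0 ω = c) (hw : RegularWeights (Z 0) μ ϑs G w)
    {θ : ℕ → ℝ} {θ₀ a : ℝ} (hθ₀ : 0 < θ₀) (hθ : ∀ᶠ n in atTop, θ₀ ≤ θ n ∧ θ n ≤ ϑs)
    (ha : ∀ᶠ n : ℕ in atTop,
      ∑ j ∈ Finset.range n, w j * deriv (cgf (Z 0) μ) (θ n * w j) = a * n) :
    Tendsto (fun n : ℕ => √(2 * Real.pi) * √(tiltedVar (cgf (Z 0) μ) w n (θ n)) *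
      expTail (tiltedLaw μ Z w a n (θ n)) (θ n) 0) atTop (𝓝 1) := by
  have hθ' : ∀ᶠ n in atTop, θ n ∈ Set.Icc 0 ϑs := hθ.mono fun n hn => ⟨hθ₀.le.trans hn.1, hn.2⟩
  have hprob : ∀ n, IsProbabilityMeasure (tiltedLaw μ Z w a n (θ n)) := fun n =>
    isProbabilityMeasure_tiltedLaw hZm hZindep hZid h w a n (θ n)
  obtain ⟨c₀, hc₀, hc₀n⟩ := hw.exists_le_tiltedVar h hX
  obtain ⟨C₀, hC₀, hC₀n⟩ := hw.exists_tiltedVar_le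
  refine tendsto_expTail_of_charFun (fun n => tiltedLaw μ Z w a n (θ n)) hθ₀ hθ
    (fun n => Real.sqrt_nonneg _) ?_ (fun x => ?_) fun T => ?_
  · refine Real.tendsto_sqrt_atTop.comp (tendsto_atTop_mono' atTop ?_
      (tendsto_natCast_atTop_atTop.const_mul_atTop hc₀))
    filter_upwards [hc₀n, hθ'] with n h1 h2 using h1 _ h2
  · refine (hw.tendsto_prod_tiltedCharFun h hX hθ' x).congr' ?_
    filter_upwards [ha] with n hn
    rw [charFun_tiltedLaw hZm hZindep hZid w hn]
  · obtain ⟨c, hc, hcn⟩ := hw.exists_norm_prod_le h hX T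
    -- The upper bound `C₀ n` on the variance converts decay in `n t²` into decay in `(N n t)²`.
    refine ⟨c / C₀, by positivity, ?_⟩
    filter_upwards [ha, hcn, hC₀n, hθ'] with n h1 h2 h3 h4 t ht
    rw [charFun_tiltedLaw hZm hZindep hZid w h1]
    refine (h2 t (abs_le.1 ht) _ h4).trans (Real.exp_le_exp.2 ?_)
    rw [mul_pow, Real.sq_sqrt (tiltedVar_nonneg h _ _ _)]
    have h5 := h3 _ h4
    calc -c * n * t ^ 2 = -(c / C₀) * ((C₀ * n) * t ^ 2) := by field_simp
      _ ≤ _ := by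
        have : c / C₀ * (tiltedVar (cgf (Z 0) μ) w n (θ n) * t ^ 2)
          ≤ c / C₀ * ((C₀ * n) * t ^ 2) := by gcongr
        linarith

end Deterministic

end CondLD

namespace CondLD

open Topology

variable {Ω : Type*} [MeasurableSpace Ω]

/-! ### The conditional distribution of the weighted sum -/

/-- The freezing lemma: by independence the joint law of `X` and `g (X, Y)` disintegrates along the
kernel `x ↦ law of g (x, Y)`, and disintegrations are almost everywhere unique. -/
lemma condDistrib_ae_eq_map_of_indepFun {E F : Type*} [MeasurableSpace E] [MeasurableSpace F]
    {μ : Measure Ω} [IsProbabilityMeasure μ] {X : Ω → E} {Y : Ω → F} {g : E × F → ℝ}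
    (hX : Measurable X) (hY : Measurable Y) (hg : Measurable g) (hXY : IndepFun X Y μ) :
    ∀ᵐ ω ∂μ, condDistrib (fun ω' => g (X ω', Y ω')) X μ (X ω) = μ.map fun ω' => g (X ω, Y ω') := by
  have := Measure.isProbabilityMeasure_map (μ := μ) hY.aemeasurable
  set κ : Kernel E ℝ := (Kernel.id ×ₖ Kernel.const E (μ.map Y)).map g with hκ
  have hκx (x : E) : κ x = μ.map fun ω' => g (x, Y ω') := by
    rw [hκ, Kernel.map_apply _ hg, Kernel.prod_apply, Kernel.id_apply, Kernel.const_apply,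
      Measure.dirac_prod, Measure.map_map measurable_prodMk_left hY,
      Measure.map_map hg (measurable_prodMk_left.comp hY)]
    rfl
  have hmk : IsMarkovKernel κ := Kernel.IsMarkovKernel.map _ hg
  have h : condDistrib (fun ω' => g (X ω', Y ω')) X μ =ᵐ[μ.map X] κ := by
    refine condDistrib_ae_eq_of_measure_eq_compProd X
      (hg.comp (hX.prodMk hY)).aemeasurable ?_
    ext s hs
    have hm : Measurable fun ω' => (X ω', g (X ω', Y ω')) := hX.prodMk (hg.comp (hX.prodMk hY))
    have hm2 : Measurable fun p : E × F => (p.1, g p) := measurable_fst.prodMk hg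
    have e1 : μ.map (fun ω' => (X ω', g (X ω', Y ω')))
        = ((μ.map X).prod (μ.map Y)).map fun p => (p.1, g p) := by
      rw [← (indepFun_iff_map_prod_eq_prod_map_map hX.aemeasurable hY.aemeasurable).1 hXY,
        Measure.map_map hm2 (hX.prodMk hY)]
      rfl
    change (μ.map fun ω' => (X ω', g (X ω', Y ω'))) s = _
    rw [e1, Measure.map_apply hm2 hs, Measure.prod_apply (hm2 hs), Measure.compProd_apply hs]
    refine lintegral_congr fun x => ?_
    have hgx : Measurable fun ω' => g (x, Y ω') := hg.comp (measurable_prodMk_left.comp hY)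
    rw [hκx, Measure.map_apply hY (measurable_prodMk_left (hm2 hs)),
      Measure.map_apply hgx (measurable_prodMk_left hs)]
    rfl
  filter_upwards [ae_of_ae_map hX.aemeasurable h] with ω hω
  rw [hω, hκx]

/-- The whole conditional law is identified for each `n`, so the exceptional set does not depend on
`a`. -/
lemma ae_condTail_eq {μ : Measure Ω} [IsProbabilityMeasure μ] {W Z : ℕ → Ω → ℝ}
    (hWm : ∀ j, Measurable (W j)) (hZm : ∀ j, Measurable (Z j))
    (hWZ : IndepFun (fun ω j => W j ω) (fun ω j => Z j ω) μ) :
    ∀ᵐ ω ∂μ, ∀ (n : ℕ) (a : ℝ), condTail μ W Z n a ω =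
      (μ.map (detSum Z (fun j => W j ω) n)).real (Set.Ici (a * n)) := by
  rw [ae_all_iff]
  intro n
  have := condDistrib_ae_eq_map_of_indepFun (μ := μ)
    (g := fun p : (ℕ → ℝ) × (ℕ → ℝ) => ∑ j ∈ Finset.range n, p.1 j * p.2 j)
    (measurable_pi_lambda _ hWm) (measurable_pi_lambda _ hZm) (by fun_prop) hWZ
  filter_upwards [this] with ω hω a
  have h2 : condDistrib (weightedSum W Z n) (fun ω' j => W j ω') μ (fun j => W j ω)
    = μ.map (detSum Z (fun j => W j ω) n) := hω
  rw [condTail, h2]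

/-! ### Exponential change of measure -/

/-- On the event, the weight `e^{-θ (S - a n)}` in `expTail` cancels the tilting density `e^{θ S} /
M` up to the constant `e^{n · rate}`. The identity holds for every `θ > 0`, not only at the saddle
point. -/
lemma real_Ici_map_detSum {μ : Measure Ω} [IsProbabilityMeasure μ] {Z : ℕ → Ω → ℝ}
    (hZm : ∀ j, Measurable (Z j)) (hZindep : iIndepFun Z μ)
    (hZid : ∀ j, IdentDistrib (Z j) (Z 0) μ μ)
    (h : ∀ t : ℝ, Integrable (fun ω => Real.exp (t * Z 0 ω)) μ)
    (w : ℕ → ℝ) (a : ℝ) {n : ℕ} (hn : n ≠ 0) {θ : ℝ} (hθ : 0 < θ) :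
    (μ.map (detSum Z w n)).real (Set.Ici (a * n)) =
      Real.exp (-n * rate (cgf (Z 0) μ) w n a θ) * expTail (tiltedLaw μ Z w a n θ) θ 0 / θ := by
  have hm := measurable_detSum hZm w n
  have hn' : (n : ℝ) ≠ 0 := Nat.cast_ne_zero.2 hn
  have hM : mgf (detSum Z w n) μ θ = Real.exp (n * Psi (cgf (Z 0) μ) w n θ) := by
    rw [mgf_detSum hZm hZindep hZid, Psi, ← mul_assoc, mul_one_div_cancel hn', one_mul,
      Real.exp_sum]
    refine Finset.prod_congr rfl fun j _ => ?_
    rw [exp_cgf (h _), mul_comm]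
  have hT : expTail (tiltedLaw μ Z w a n θ) θ 0 =
      θ * Real.exp (n * rate (cgf (Z 0) μ) w n a θ) *
        (μ.map (detSum Z w n)).real (Set.Ici (a * n)) := by
    simp_rw [expTail, sub_zero]
    rw [tiltedLaw, integral_map (hm.sub_const _).aemeasurable
      (measurable_expDensity θ).aestronglyMeasurable,
      integral_tilted_mul_eq_mgf, hM, map_measureReal_apply hm measurableSet_Ici,
      ← integral_indicator_one (hm measurableSet_Ici), ← integral_const_mul]
    congr 1; ext ω
    by_cases hω : a * n ≤ detSum Z w n ω
    · rw [Set.indicator_of_mem (show ω ∈ detSum Z w n ⁻¹' Set.Ici (a * n) from hω), expDensity,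
        if_pos (sub_nonneg.2 hω), Pi.one_apply, mul_one, smul_eq_mul, ← Real.exp_sub,
        mul_left_comm, ← Real.exp_add, rate]
      congr 2; ring
    · rw [Set.indicator_of_notMem (show ω ∉ detSum Z w n ⁻¹' Set.Ici (a * n) from hω), expDensity,
        if_neg (by rwa [sub_nonneg]), mul_zero, smul_zero]
  rw [hT, neg_mul, Real.exp_neg]
  field_simp

/-! ### Consequences of the strong law of large numbers -/

section StrongLaw

variable {μ : Measure Ω} {W : ℕ → Ω → ℝ}
  (hWindep : iIndepFun W μ) (hWid : ∀ j, IdentDistrib (W j) (W 0) μ μ)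

include hWindep hWid

lemma ae_tendsto_average_comp {g : ℝ → ℝ} (hg : Measurable g)
    (hgi : Integrable (fun ω => g (W 0 ω)) μ) :
    ∀ᵐ ω ∂μ, Tendsto (fun n : ℕ => (∑ j ∈ Finset.range n, g (W j ω)) / n) atTop
      (𝓝 (∫ ω, g (W 0 ω) ∂μ)) :=
  strong_law_ae_real (fun j ω => g (W j ω)) hgi
    (fun _ _ hij => (hWindep.indepFun hij).comp hg hg) fun j => (hWid j).comp hg

/-- To have one null set for all `w₀` and `r`, the strong law is applied to the countably many
rational intervals, one of which fits around `w₀` inside the ball. -/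
lemma ae_frequency_pos [IsProbabilityMeasure μ] (hWm : ∀ j, Measurable (W j)) :
    ∀ᵐ ω ∂μ, ∀ w₀ : ℝ, (∀ r > 0, 0 < μ {ω' | |W 0 ω' - w₀| < r}) →
      ∀ r > 0, ∃ p > 0, ∀ᶠ n : ℕ in atTop,
        p * n ≤ ∑ j ∈ Finset.range n, if |W j ω - w₀| < r then (1 : ℝ) else 0 := by
  have hae : ∀ᵐ ω ∂μ, ∀ q : ℚ × ℚ, Tendsto (fun n : ℕ =>
      (∑ j ∈ Finset.range n, (Set.Ioo (q.1 : ℝ) q.2).indicator (1 : ℝ → ℝ) (W j ω)) / n) atTop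
      (𝓝 (∫ ω, (Set.Ioo (q.1 : ℝ) q.2).indicator (1 : ℝ → ℝ) (W 0 ω) ∂μ)) := by
    rw [ae_all_iff]
    intro q
    have hm : Measurable ((Set.Ioo (q.1 : ℝ) q.2).indicator (1 : ℝ → ℝ)) :=
      measurable_one.indicator measurableSet_Ioo
    refine ae_tendsto_average_comp hWindep hWid hm (Integrable.of_bound (C := 1)
      (hm.comp (hWm 0)).aestronglyMeasurable (Eventually.of_forall fun ω => ?_))
    rw [Set.indicator_apply]; split_ifs <;> simp
  filter_upwards [hae] with ω hω w₀ hw₀ r hr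
  obtain ⟨q₁, hq₁, hq₁'⟩ := exists_rat_btwn (show w₀ - r < w₀ by linarith)
  obtain ⟨q₂, hq₂, hq₂'⟩ := exists_rat_btwn (show w₀ < w₀ + r by linarith)
  have hlim := hω (q₁, q₂)
  have hval : ∫ ω, (Set.Ioo (q₁ : ℝ) q₂).indicator (1 : ℝ → ℝ) (W 0 ω) ∂μ
      = μ.real (W 0 ⁻¹' Set.Ioo (q₁ : ℝ) q₂) := by
    rw [← integral_indicator_one (hWm 0 measurableSet_Ioo)]
    rfl
  simp only [hval] at hlim
  set P := μ.real (W 0 ⁻¹' Set.Ioo (q₁ : ℝ) q₂)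
  have hP : 0 < P := by
    refine ENNReal.toReal_pos ?_ (measure_ne_top _ _)
    refine ((hw₀ (min (w₀ - q₁) (q₂ - w₀)) (lt_min (by linarith) (by linarith))).trans_le
      (measure_mono fun ω' hω' => ?_)).ne'
    rw [Set.mem_ofPred_eq, abs_lt] at hω'
    have h1 := min_le_left (w₀ - q₁) (q₂ - w₀)
    have h2 := min_le_right (w₀ - q₁) (q₂ - w₀)
    constructor <;> linarith [hω'.1, hω'.2]
  refine ⟨P / 2, by positivity, ?_⟩
  filter_upwards [hlim.eventually (lt_mem_nhds (half_lt_self hP)), eventually_gt_atTop 0]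
    with n hn hn0
  have hn0' : (0 : ℝ) < n := Nat.cast_pos.2 hn0
  rw [lt_div_iff₀ hn0'] at hn
  refine hn.le.trans (Finset.sum_le_sum fun j _ => ?_)
  simp only [Set.indicator_apply, Pi.one_apply]
  split_ifs with h1 h2 h2
  · exact le_rfl
  · exact absurd (abs_lt.2 ⟨by linarith [h1.1], by linarith [h1.2]⟩) h2
  · exact zero_le_one
  · exact le_rfl

/-- Truncated expectations vanish as the level grows, by dominated convergence; integer levels
suffice, so countably many strong laws are used. -/
lemma ae_tail_average_le [IsProbabilityMeasure μ] (hWm : ∀ j, Measurable (W j)) {G : ℝ → ℝ} (hG : Measurable G)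
    (hGi : Integrable (fun ω => G (W 0 ω)) μ) :
    ∀ᵐ ω ∂μ, ∀ ε > 0, ∃ K ≥ (0 : ℝ), ∀ᶠ n : ℕ in atTop,
      ∑ j ∈ Finset.range n, (if K < |W j ω| then G (W j ω) else 0) ≤ ε * n := by
  have hm (k : ℕ) : Measurable fun x : ℝ => if (k : ℝ) < |x| then G x else 0 :=
    Measurable.ite (measurableSet_lt measurable_const (by fun_prop)) hG measurable_const
  have hle (k : ℕ) (ω : Ω) : ‖(if (k : ℝ) < |W 0 ω| then G (W 0 ω) else 0)‖ ≤ ‖G (W 0 ω)‖ := by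
    split_ifs
    · exact le_rfl
    · simp
  have hlim : Tendsto (fun k : ℕ => ∫ ω, (if (k : ℝ) < |W 0 ω| then G (W 0 ω) else 0) ∂μ) atTop
      (𝓝 (∫ _, (0 : ℝ) ∂μ)) := by
    refine tendsto_integral_of_dominated_convergence _
      (fun k => ((hm k).comp (hWm 0)).aestronglyMeasurable) hGi.norm
      (fun k => Eventually.of_forall (hle k)) (Eventually.of_forall fun ω => ?_)
    refine tendsto_const_nhds.congr' ?_
    filter_upwards [tendsto_natCast_atTop_atTop.eventually_ge_atTop |W 0 ω|] with k hk
    rw [if_neg (not_lt.2 hk)]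
  rw [integral_zero] at hlim
  have hae : ∀ᵐ ω ∂μ, ∀ k : ℕ, Tendsto (fun n : ℕ =>
      (∑ j ∈ Finset.range n, if (k : ℝ) < |W j ω| then G (W j ω) else 0) / n) atTop
      (𝓝 (∫ ω, (if (k : ℝ) < |W 0 ω| then G (W 0 ω) else 0) ∂μ)) := by
    rw [ae_all_iff]
    intro k
    have hi : Integrable (fun ω => if (k : ℝ) < |W 0 ω| then G (W 0 ω) else 0) μ :=
      hGi.mono ((hm k).comp (hWm 0)).aestronglyMeasurable (Eventually.of_forall (hle k))
    exact ae_tendsto_average_comp (g := fun x => if (k : ℝ) < |x| then G x else 0)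
      hWindep hWid (hm k) hi
  filter_upwards [hae] with ω hω ε hε
  obtain ⟨k, hk⟩ := (hlim.eventually (gt_mem_nhds hε)).exists
  refine ⟨k, Nat.cast_nonneg k, ?_⟩
  filter_upwards [(hω k).eventually (gt_mem_nhds hk), eventually_gt_atTop 0] with n hn hn0
  rw [div_lt_iff₀ (Nat.cast_pos.2 hn0)] at hn
  exact hn.le

end StrongLaw

/-! ### Non-arithmetic points in the support of the weights -/

section Support

variable {μ : Measure Ω} {X Y : Ω → ℝ}

lemma latticeValued_of_arithmeticAt {s : ℝ} (hs : s ≠ 0) (h : ArithmeticAt X μ s) :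
    LatticeValued μ X := by
  obtain ⟨β, hβ⟩ := h
  have hpi := Real.pi_pos
  refine ⟨β / s, |2 * Real.pi / s|, by positivity, hβ.mono fun ω ⟨k, hk⟩ => ?_⟩
  rcases abs_choice (2 * Real.pi / s) with habs | habs <;> rw [habs]
  · exact ⟨k, by field_simp; linarith⟩
  · exact ⟨-k, by push_cast; field_simp; linarith⟩

lemma exists_two_atoms_of_latticeValued [IsProbabilityMeasure μ] (hX : ¬ ∃ c : ℝ, ∀ᵐ ω ∂μ, X ω = c) {b h : ℝ}
    (hbh : ∀ᵐ ω ∂μ, ∃ k : ℤ, X ω = b + k * h) :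
    ∃ k₁ k₂ : ℤ, k₁ ≠ k₂ ∧ (∃ᵐ ω ∂μ, X ω = b + k₁ * h) ∧ ∃ᵐ ω ∂μ, X ω = b + k₂ * h := by
  obtain ⟨k₁, hk₁⟩ : ∃ k₁ : ℤ, ∃ᵐ ω ∂μ, X ω = b + k₁ * h := by
    by_contra! hcon
    rw [← ae_all_iff] at hcon
    obtain ⟨ω, ⟨k, hk⟩, hω⟩ := (hbh.and hcon).exists
    exact hω k hk
  by_contra! hcon
  refine hX ⟨b + k₁ * h, ?_⟩
  have h2 : ∀ᵐ ω ∂μ, ∀ k : ℤ, k ≠ k₁ → X ω ≠ b + k * h := by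
    rw [ae_all_iff]
    intro k
    by_cases hk : k = k₁
    · exact Eventually.of_forall fun ω hne => absurd hk hne
    · exact (hcon k₁ k (Ne.symm hk) hk₁).mono fun ω hω _ => hω
  filter_upwards [hbh, h2] with ω ⟨k, hk⟩ hω
  by_cases hkk : k = k₁
  · rw [hk, hkk]
  · exact absurd hk (hω k hkk)

/-- Two distinct atoms `b + k₁ h` and `b + k₂ h` force `s h (k₁ - k₂) ∈ 2π ℤ`. -/
lemma countable_setOf_arithmeticAt [IsProbabilityMeasure μ] (hX : ¬ ∃ c : ℝ, ∀ᵐ ω ∂μ, X ω = c) (hl : LatticeValued μ X) :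
    {s : ℝ | ArithmeticAt X μ s}.Countable := by
  obtain ⟨b, h, hh, hbh⟩ := hl
  obtain ⟨k₁, k₂, hne, hk₁, hk₂⟩ := exists_two_atoms_of_latticeValued hX hbh
  refine (Set.countable_range fun m : ℤ => m * (2 * Real.pi) / (h * (k₁ - k₂))).mono ?_
  rintro s ⟨β, hβ⟩
  obtain ⟨ω₁, h1, m₁, hm₁⟩ := (hk₁.and_eventually hβ).exists
  obtain ⟨ω₂, h2, m₂, hm₂⟩ := (hk₂.and_eventually hβ).exists
  refine ⟨m₁ - m₂, ?_⟩
  have hne' : (k₁ : ℝ) - k₂ ≠ 0 := sub_ne_zero.2 (by exact_mod_cast hne)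
  rw [h1] at hm₁
  rw [h2] at hm₂
  simp only
  rw [div_eq_iff (mul_ne_zero hh.ne' hne')]
  push_cast
  linear_combination -hm₁ + hm₂

/-- In the lattice case only countably many `y` are bad, and the density bound puts all of `(c, d)`
in the support of `Y`. Otherwise `X` is not arithmetic at any nonzero frequency, and any nonzero
support point works. -/
lemma exists_support_not_arithmeticAt [IsProbabilityMeasure μ] (hYm : Measurable Y)
    (hX : ¬ ∃ c : ℝ, ∀ᵐ ω ∂μ, X ω = c) (hY : ¬ ∀ᵐ ω ∂μ, Y ω = 0)
    (hlattice : LatticeValued μ X → DensityBoundedBelow μ Y) (t : ℝ) :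
    ∃ y : ℝ, y ≠ 0 ∧ (t ≠ 0 → ¬ ArithmeticAt X μ (y * t)) ∧
      ∀ r > 0, 0 < μ {ω | |Y ω - y| < r} := by
  by_cases hl : LatticeValued μ X
  · obtain ⟨c, d, p, hcd, hp, hden⟩ := hlattice hl
    have hcount : ({0} ∪ {y : ℝ | t ≠ 0 ∧ ArithmeticAt X μ (y * t)}).Countable := by
      refine (Set.countable_singleton 0).union ?_
      by_cases ht : t = 0
      · simp [ht]
      · refine ((countable_setOf_arithmeticAt hX hl).preimage
          (mul_left_injective₀ ht)).mono fun y hy => hy.2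
    obtain ⟨y, hy, hyn⟩ := (hcount.dense_compl ℝ).exists_mem_open isOpen_Ioo
      (Set.nonempty_Ioo.2 hcd)
    rw [Set.mem_compl_iff, Set.mem_union, not_or] at hy
    refine ⟨y, by simpa using hy.1, fun ht har => hy.2 ⟨ht, har⟩, fun r hr => ?_⟩
    have hopen : IsOpen (Metric.ball y r ∩ Set.Ioo c d) := Metric.isOpen_ball.inter isOpen_Ioo
    have hvol : 0 < (volume : Measure ℝ) (Metric.ball y r ∩ Set.Ioo c d) :=
      hopen.measure_pos _ ⟨y, Metric.mem_ball_self hr, hyn⟩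
    calc 0 < ENNReal.ofReal p * (volume : Measure ℝ) (Metric.ball y r ∩ Set.Ioo c d) :=
          ENNReal.mul_pos (by simpa using hp) hvol.ne'
      _ = ∫⁻ _ in Metric.ball y r ∩ Set.Ioo c d, ENNReal.ofReal p := by
          rw [setLIntegral_const]
      _ ≤ ∫⁻ x in Metric.ball y r ∩ Set.Ioo c d, (μ.map Y).rnDeriv volume x := by
          refine lintegral_mono_ae ((ae_restrict_iff' hopen.measurableSet).2 ?_)
          filter_upwards [hden] with x hx hxm
          exact hx (Set.Ioo_subset_Icc_self hxm.2)
      _ ≤ (μ.map Y) (Metric.ball y r ∩ Set.Ioo c d) := Measure.setLIntegral_rnDeriv_le _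
      _ ≤ (μ.map Y) (Metric.ball y r) := measure_mono Set.inter_subset_left
      _ = μ {ω | |Y ω - y| < r} := by
          rw [Measure.map_apply hYm measurableSet_ball]; rfl
  · have hpos : μ.map Y {0}ᶜ ≠ 0 := by
      rw [Measure.map_apply hYm (measurableSet_singleton 0).compl]
      exact hY
    obtain ⟨y, hy, hyn⟩ := exists_mem_forall_mem_nhdsWithin_pos_measure hpos
    refine ⟨y, hy, fun ht har => hl (latticeValued_of_arithmeticAt (mul_ne_zero hy ht) har),
      fun r hr => ?_⟩
    have := hyn _ (mem_nhdsWithin_of_mem_nhds (Metric.ball_mem_nhds y hr))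
    rwa [Measure.map_apply hYm measurableSet_ball] at this

end Support

/-! ### The dominating function -/

/-- `sup_{θ ∈ [0, ϑs]} x² f''(θ x)`. -/
def varSup (f : ℝ → ℝ) (ϑs x : ℝ) : ℝ :=
  sSup ((fun θ => x ^ 2 * iteratedDeriv 2 f (θ * x)) '' Set.Icc 0 ϑs)

lemma continuous_varSup {f : ℝ → ℝ} (hf : Continuous (iteratedDeriv 2 f)) (ϑs : ℝ) :
    Continuous (varSup f ϑs) :=
  isCompact_Icc.continuous_sSup (f := fun x θ => x ^ 2 * iteratedDeriv 2 f (θ * x)) (by fun_prop)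

lemma le_varSup {f : ℝ → ℝ} (hf : Continuous (iteratedDeriv 2 f)) {ϑs θ : ℝ}
    (hθ : θ ∈ Set.Icc 0 ϑs) (x : ℝ) : x ^ 2 * iteratedDeriv 2 f (θ * x) ≤ varSup f ϑs x := by
  have hc : Continuous fun θ => x ^ 2 * iteratedDeriv 2 f (θ * x) := by fun_prop
  exact le_csSup (isCompact_Icc.image hc).bddAbove ⟨θ, hθ, rfl⟩

/-- `F` need not be measurable and its exceptional set depends on `θ`. The supremum is continuous in
`x`, and by continuity in `θ` a dense sequence of parameters shows that it is dominated by `F`. -/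
lemma integrable_varSup {μ : Measure Ω} {f : ℝ → ℝ} (hf : Continuous (iteratedDeriv 2 f))
    (hf0 : ∀ x, 0 ≤ iteratedDeriv 2 f x) {ϑs : ℝ} (hϑs : 0 ≤ ϑs) {Y : Ω → ℝ} (hY : Measurable Y)
    {F : ℝ → ℝ} (hF : Integrable (fun ω => F (Y ω)) μ)
    (hdom : ∀ θ ∈ Set.Icc 0 ϑs, ∀ᵐ ω ∂μ, Y ω ^ 2 * iteratedDeriv 2 f (θ * Y ω) ≤ F (Y ω)) :
    Integrable (fun ω => varSup f ϑs (Y ω)) μ := by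
  have hne : (Set.Icc 0 ϑs).Nonempty := ⟨0, le_rfl, hϑs⟩
  have : Nonempty (Set.Icc 0 ϑs) := hne.to_subtype
  have hae : ∀ᵐ ω ∂μ, ∀ n : ℕ, Y ω ^ 2 *
      iteratedDeriv 2 f ((TopologicalSpace.denseSeq (Set.Icc 0 ϑs) n : ℝ) * Y ω) ≤ F (Y ω) := by
    rw [ae_all_iff]
    exact fun n => hdom _ (TopologicalSpace.denseSeq (Set.Icc 0 ϑs) n).2
  refine hF.mono' ((continuous_varSup hf ϑs).measurable.comp hY).aestronglyMeasurable ?_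
  filter_upwards [hae] with ω hω
  have hall : ∀ θ : Set.Icc 0 ϑs, Y ω ^ 2 * iteratedDeriv 2 f ((θ : ℝ) * Y ω) ≤ F (Y ω) := by
    have hcl : IsClosed {θ : Set.Icc 0 ϑs | Y ω ^ 2 * iteratedDeriv 2 f ((θ : ℝ) * Y ω) ≤ F (Y ω)} :=
      isClosed_le (by fun_prop) continuous_const
    exact isClosed_property (TopologicalSpace.denseRange_denseSeq _) hcl hω
  have h0 : 0 ≤ varSup f ϑs (Y ω) :=
    (mul_nonneg (sq_nonneg _) (hf0 _)).trans (le_varSup hf (θ := 0) ⟨le_rfl, hϑs⟩ _)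
  rw [Real.norm_of_nonneg h0]
  refine csSup_le (hne.image _) ?_
  rintro _ ⟨θ, hθ, rfl⟩
  exact hall ⟨θ, hθ⟩

lemma ae_regularWeights {μ : Measure Ω} [IsProbabilityMeasure μ] {W : ℕ → Ω → ℝ} {X : Ω → ℝ}
    (hWm : ∀ j, Measurable (W j)) (hWindep : iIndepFun W μ)
    (hWid : ∀ j, IdentDistrib (W j) (W 0) μ μ) {ϑs : ℝ} (hϑs : 0 ≤ ϑs)
    (hX : ¬ ∃ c : ℝ, ∀ᵐ ω ∂μ, X ω = c) (hW : ¬ ∀ᵐ ω ∂μ, W 0 ω = 0)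
    (hlattice : LatticeValued μ X → DensityBoundedBelow μ (W 0))
    (h : ∀ t : ℝ, Integrable (fun ω => Real.exp (t * X ω)) μ)
    (hG : Integrable (fun ω => varSup (cgf X μ) ϑs (W 0 ω)) μ) :
    ∀ᵐ ω ∂μ, RegularWeights X μ ϑs (varSup (cgf X μ) ϑs) fun j => W j ω := by
  have hf := continuous_iteratedDeriv_two_cgf h
  have hGm := (continuous_varSup hf ϑs).measurable
  filter_upwards [ae_tendsto_average_comp hWindep hWid hGm hG,
    ae_tail_average_le hWindep hWid hWm hGm hG, ae_frequency_pos hWindep hWid hWm] with ω h1 h2 h3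
  refine ⟨fun j θ hθ => le_varSup hf hθ _, ?_, h2, fun t => ?_⟩
  · have hG0 : 0 ≤ ∫ ω, varSup (cgf X μ) ϑs (W 0 ω) ∂μ := integral_nonneg fun ω =>
      (mul_nonneg (sq_nonneg _) (iteratedDeriv_two_cgf_nonneg h _)).trans
        (le_varSup hf (θ := 0) ⟨le_rfl, hϑs⟩ _)
    refine ⟨∫ ω, varSup (cgf X μ) ϑs (W 0 ω) ∂μ + 1, by linarith, ?_⟩
    filter_upwards [h1.eventually (gt_mem_nhds (lt_add_one _)), eventually_gt_atTop 0]
      with n hn hn0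
    rw [div_lt_iff₀ (Nat.cast_pos.2 hn0)] at hn
    exact hn.le
  · obtain ⟨y, hy0, hyt, hyr⟩ := exists_support_not_arithmeticAt (hWm 0) hX hW hlattice t
    exact ⟨y, hy0, hyt, h3 y hyr⟩

/-! ### Derivatives of `Psi` -/

section PsiDeriv

variable {f : ℝ → ℝ} {w : ℕ → ℝ}

lemma deriv_Psi (hf : ∀ x, HasDerivAt f (deriv f x) x) (n : ℕ) :
    deriv (Psi f w n) = fun θ => (∑ j ∈ Finset.range n, w j * deriv f (θ * w j)) / n := by
  ext θ
  refine HasDerivAt.deriv ?_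
  have h1 : HasDerivAt (fun θ => (1 / (n : ℝ)) * ∑ j ∈ Finset.range n, f (w j * θ))
      ((1 / (n : ℝ)) * ∑ j ∈ Finset.range n, w j * deriv f (θ * w j)) θ := by
    refine (HasDerivAt.fun_sum fun j _ => ?_).const_mul _
    have := (hf (w j * θ)).comp θ ((hasDerivAt_id θ).const_mul (w j))
    rw [mul_one, mul_comm (deriv f _), mul_comm (w j) θ] at this
    exact this
  rw [div_eq_inv_mul, ← one_div]
  exact h1

lemma hasDerivAt_deriv_Psi (hf : ∀ x, HasDerivAt f (deriv f x) x)
    (hf' : ∀ x, HasDerivAt (deriv f) (iteratedDeriv 2 f x) x) (n : ℕ) (θ : ℝ) :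
    HasDerivAt (deriv (Psi f w n)) (tiltedVar f w n θ / n) θ := by
  rw [deriv_Psi hf]
  refine (HasDerivAt.fun_sum fun j _ => ?_).div_const _
  have := ((hf' (θ * w j)).comp θ ((hasDerivAt_id θ).mul_const (w j))).const_mul (w j)
  simp only [one_mul] at this
  rw [show w j ^ 2 * iteratedDeriv 2 f (θ * w j) = w j * (iteratedDeriv 2 f (θ * w j) * w j) by ring]
  exact this

lemma sigma_eq (hf : ∀ x, HasDerivAt f (deriv f x) x)
    (hf' : ∀ x, HasDerivAt (deriv f) (iteratedDeriv 2 f x) x) (n : ℕ) (θ : ℝ) :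
    sigma f w n θ = √(tiltedVar f w n θ / n) := by
  rw [sigma, iteratedDeriv_succ, iteratedDeriv_one, (hasDerivAt_deriv_Psi hf hf' n θ).deriv]

lemma tiltedVar_pos (hf0 : ∀ x, 0 < iteratedDeriv 2 f x) {n j : ℕ} (hj : j < n) (hwj : w j ≠ 0)
    (θ : ℝ) : 0 < tiltedVar f w n θ :=
  Finset.sum_pos' (fun i _ => mul_nonneg (sq_nonneg _) (hf0 _).le)
    ⟨j, Finset.mem_range.2 hj, mul_pos (by positivity) (hf0 _)⟩

lemma strictMono_deriv_Psi (hf : ∀ x, HasDerivAt f (deriv f x) x)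
    (hf' : ∀ x, HasDerivAt (deriv f) (iteratedDeriv 2 f x) x)
    (hf0 : ∀ x, 0 < iteratedDeriv 2 f x) {n j : ℕ} (hj : j < n) (hwj : w j ≠ 0) :
    StrictMono (deriv (Psi f w n)) := by
  refine strictMono_of_deriv_pos fun θ => ?_
  rw [(hasDerivAt_deriv_Psi hf hf' n θ).deriv]
  exact div_pos (tiltedVar_pos hf0 hj hwj θ) (Nat.cast_pos.2 (Nat.zero_lt_of_lt hj))

lemma RegularWeights.eventually_exists_ne_zero {X : Ω → ℝ} {μ : Measure Ω} {ϑs : ℝ} {G : ℝ → ℝ}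
    (hw : RegularWeights X μ ϑs G w) : ∀ᶠ n in atTop, ∃ j < n, w j ≠ 0 := by
  obtain ⟨w₀, hw₀, -, hp⟩ := hw.spread 0
  -- The open ball of radius `|w₀|` around `w₀` excludes `0`, so every weight counted is nonzero.
  obtain ⟨p, hp0, hpn⟩ := hp |w₀| (abs_pos.2 hw₀)
  filter_upwards [hpn, eventually_gt_atTop 0] with n hn hn0
  by_contra! hcon
  have : ∑ j ∈ Finset.range n, (if |w j - w₀| < |w₀| then (1 : ℝ) else 0) = 0 := by
    refine Finset.sum_eq_zero fun j hj => ?_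
    rw [hcon j (Finset.mem_range.1 hj), zero_sub, abs_neg, if_neg (lt_irrefl _)]
  rw [this] at hn
  have : (0 : ℝ) < p * n := mul_pos hp0 (Nat.cast_pos.2 hn0)
  linarith

end PsiDeriv

/-! ### Existence, uniqueness and asymptotics of the saddle point equation -/

lemma monotone_mul_comp_mul {g : ℝ → ℝ} (hg : Monotone g) (w : ℝ) :
    Monotone fun θ => w * g (θ * w) := by
  intro θ θ' hθ
  rcases le_total 0 w with hw | hw
  · exact mul_le_mul_of_nonneg_left (hg (mul_le_mul_of_nonneg_right hθ hw)) hw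
  · exact mul_le_mul_of_nonpos_left (hg (mul_le_mul_of_nonpos_right hθ hw)) hw

/-- The integrand is monotone in `θ` whatever the sign of `Y`, so its values at `0` and `ϑs`
dominate it. -/
lemma tendsto_integral_mul_comp_mul {μ : Measure Ω} {Y : Ω → ℝ} {g : ℝ → ℝ} (hg : Monotone g)
    (hgc : Continuous g) {ϑs : ℝ} (hint : ∀ θ : ℝ, Integrable (fun ω => Y ω * g (θ * Y ω)) μ)
    {θ : ℕ → ℝ} (hθ : ∀ m, θ m ∈ Set.Icc 0 ϑs) (hlim : Tendsto θ atTop (𝓝 0)) :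
    Tendsto (fun m => ∫ ω, Y ω * g (θ m * Y ω) ∂μ) atTop (𝓝 (∫ ω, Y ω * g (0 * Y ω) ∂μ)) := by
  refine tendsto_integral_of_dominated_convergence
    (fun ω => |Y ω * g (0 * Y ω)| + |Y ω * g (ϑs * Y ω)|) (fun m => (hint _).aestronglyMeasurable)
    ((hint 0).abs.add (hint ϑs).abs) (fun m => Eventually.of_forall fun ω => ?_)
    (Eventually.of_forall fun ω => ?_)
  · have h1 := monotone_mul_comp_mul hg (Y ω) (hθ m).1
    have h2 := monotone_mul_comp_mul hg (Y ω) (hθ m).2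
    simp only at h1 h2
    rw [Real.norm_eq_abs, abs_le]
    have h3 := neg_abs_le (Y ω * g (0 * Y ω))
    have h4 := le_abs_self (Y ω * g (ϑs * Y ω))
    have h5 := abs_nonneg (Y ω * g (0 * Y ω))
    have h6 := abs_nonneg (Y ω * g (ϑs * Y ω))
    constructor <;> linarith
  · have : Continuous fun θ => Y ω * g (θ * Y ω) := by fun_prop
    exact (this.tendsto 0).comp hlim

lemma ae_tendsto_deriv_Psi {μ : Measure Ω} {W : ℕ → Ω → ℝ} (hWindep : iIndepFun W μ)
    (hWid : ∀ j, IdentDistrib (W j) (W 0) μ μ) {f : ℝ → ℝ}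
    (hf : ∀ x, HasDerivAt f (deriv f x) x) (hfc : Continuous (deriv f)) {θ : ℝ}
    (hint : Integrable (fun ω => W 0 ω * deriv f (θ * W 0 ω)) μ) :
    ∀ᵐ ω ∂μ, Tendsto (fun n => deriv (Psi f (fun j => W j ω) n) θ) atTop
      (𝓝 (∫ ω, W 0 ω * deriv f (θ * W 0 ω) ∂μ)) := by
  have hm : Measurable fun x => x * deriv f (θ * x) :=
    (continuous_id.mul (hfc.comp (continuous_const.mul continuous_id))).measurable
  filter_upwards [ae_tendsto_average_comp hWindep hWid hm hint] with ω hω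
  simp_rw [deriv_Psi hf]
  exact hω

/-- Exact asymptotics of the tail probabilities for a regular sequence of weights. -/
theorem RegularWeights.isEquivalent_tail {μ : Measure Ω} [IsProbabilityMeasure μ]
    {Z : ℕ → Ω → ℝ} (hZm : ∀ j, Measurable (Z j))
    (hZindep : iIndepFun Z μ) (hZid : ∀ j, IdentDistrib (Z j) (Z 0) μ μ)
    (h : ∀ t : ℝ, Integrable (fun ω => Real.exp (t * Z 0 ω)) μ)
    (hX : ¬ ∃ c : ℝ, ∀ᵐ ω ∂μ, Z 0 ω = c) {ϑs : ℝ} {G : ℝ → ℝ} {w : ℕ → ℝ}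
    (hw : RegularWeights (Z 0) μ ϑs G w) {θ : ℕ → ℝ} {θ₀ a : ℝ} (hθ₀ : 0 < θ₀)
    (hθ : ∀ᶠ n in atTop, θ₀ ≤ θ n ∧ θ n ≤ ϑs)
    (ha : ∀ᶠ n : ℕ in atTop, deriv (Psi (cgf (Z 0) μ) w n) (θ n) = a) :
    (∀ᶠ n : ℕ in atTop, 0 < θ n ∧ 0 < sigma (cgf (Z 0) μ) w n (θ n)) ∧
      (fun n : ℕ => (μ.map (detSum Z w n)).real (Set.Ici (a * n))) ~[atTop]
        fun n : ℕ => Real.exp (-(n : ℝ) * rate (cgf (Z 0) μ) w n a (θ n)) /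
          (√(2 * Real.pi * n) * θ n * sigma (cgf (Z 0) μ) w n (θ n)) := by
  have hpi := Real.pi_pos
  have hd1 := hasDerivAt_cgf h
  have hd2 := hasDerivAt_deriv_cgf h
  have hpos : ∀ᶠ n : ℕ in atTop, 0 < tiltedVar (cgf (Z 0) μ) w n (θ n) :=
    hw.eventually_exists_ne_zero.mono fun n ⟨j, hj, hwj⟩ =>
      tiltedVar_pos (iteratedDeriv_two_cgf_pos h hX) hj hwj _
  constructor
  · filter_upwards [hθ, hpos, eventually_gt_atTop 0] with n hn hv hn0
    refine ⟨hθ₀.trans_le hn.1, ?_⟩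
    rw [sigma_eq hd1 hd2]
    exact Real.sqrt_pos.2 (div_pos hv (Nat.cast_pos.2 hn0))
  · have ha' : ∀ᶠ n : ℕ in atTop,
        ∑ j ∈ Finset.range n, w j * deriv (cgf (Z 0) μ) (θ n * w j) = a * n := by
      filter_upwards [ha, eventually_gt_atTop 0] with n hn hn0
      rw [deriv_Psi hd1] at hn
      exact (div_eq_iff (Nat.cast_pos.2 hn0).ne').1 hn
    refine isEquivalent_of_tendsto_one
      ((hw.tendsto_expTail_tiltedLaw hZm hZindep hZid h hX hθ₀ hθ ha').congr' ?_)
    filter_upwards [hθ, hpos, eventually_gt_atTop 0] with n hn hv hn0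
    have hθn := hθ₀.trans_le hn.1
    have hn0' : (0 : ℝ) < n := Nat.cast_pos.2 hn0
    rw [Pi.div_apply, real_Ici_map_detSum hZm hZindep hZid h w a hn0.ne' hθn, sigma_eq hd1 hd2,
      Real.sqrt_div' _ hn0'.le,
      show √(2 * Real.pi * n) = √(2 * Real.pi) * √n from Real.sqrt_mul (by positivity) _]
    have h1 : √(n : ℝ) ≠ 0 := (Real.sqrt_pos.2 hn0').ne'
    have h2 : √(tiltedVar (cgf (Z 0) μ) w n (θ n)) ≠ 0 := (Real.sqrt_pos.2 hv).ne'
    have h3 : √(2 * Real.pi) ≠ 0 := (Real.sqrt_pos.2 (by positivity)).ne'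
    have h4 := (Real.exp_pos (-(n : ℝ) * rate (cgf (Z 0) μ) w n a (θ n))).ne'
    generalize Real.exp (-(n : ℝ) * rate (cgf (Z 0) μ) w n a (θ n)) = e at h4 ⊢
    field_simp

end CondLD

end

/-! ### The almost sure statement, simultaneously for all levels `a`. -/

theorem theorem2 {Ω : Type*} [MeasurableSpace Ω] (μ : Measure Ω) [IsProbabilityMeasure μ]
    (W Z : ℕ → Ω → ℝ)
    (hWm : ∀ j, Measurable (W j)) (hZm : ∀ j, Measurable (Z j))
    (hWindep : iIndepFun W μ) (hWid : ∀ j, IdentDistrib (W j) (W 0) μ μ)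
    (hZindep : iIndepFun Z μ) (hZid : ∀ j, IdentDistrib (Z j) (Z 0) μ μ)
    (hWZ : IndepFun (fun ω j => W j ω) (fun ω j => Z j ω) μ)
    (f : ℝ → ℝ) (hf : f = cgf (Z 0) μ)
    (ϑs : ℝ) (hϑs : 0 < ϑs)
    -- (i) non-degeneracy and the two non-lattice conditions
    (hZnondeg : ¬ ∃ c : ℝ, ∀ᵐ ω ∂μ, Z 0 ω = c)
    (hlattice : CondLD.LatticeValued μ (Z 0) → CondLD.DensityBoundedBelow μ (W 0))
    (hdensity : μ.map (Z 0) ≪ volume → 0 < μ {ω | 0 < |W 0 ω|})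
    -- (ii) finite moment generating function
    (hmgf : ∀ ϑ : ℝ, Integrable (fun ω => Real.exp (ϑ * Z 0 ω)) μ)
    -- (iii) integrability
    (hint : ∀ ϑ : ℝ, Integrable (fun ω => f (ϑ * W 0 ω)) μ)
    (hint' : ∀ ϑ : ℝ, Integrable (fun ω => W 0 ω * deriv f (ϑ * W 0 ω)) μ)
    -- (iv) domination
    (hdom : ∃ F : ℝ → ℝ, Integrable (fun ω => F (W 0 ω)) μ ∧
      ∀ ϑ ∈ Set.Icc 0 ϑs, ∀ᵐ ω ∂μ,
        W 0 ω ^ 2 * iteratedDeriv 2 f (ϑ * W 0 ω) ≤ F (W 0 ω)) :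
    ∀ᵐ ω ∂μ, ∀ a ∈ Set.Ioo ((∫ ω', W 0 ω' ∂μ) * ∫ ω', Z 0 ω' ∂μ)
        (∫ ω', W 0 ω' * deriv f (ϑs * W 0 ω') ∂μ),
      (∀ᶠ n : ℕ in atTop, ∃! ϑ : ℝ, deriv (CondLD.Psi f (fun j => W j ω) n) ϑ = a) ∧
      ∀ ϑ : ℕ → ℝ, (∀ᶠ n : ℕ in atTop, deriv (CondLD.Psi f (fun j => W j ω) n) (ϑ n) = a) →
        (∀ᶠ n : ℕ in atTop, 0 < ϑ n ∧ 0 < CondLD.sigma f (fun j => W j ω) n (ϑ n)) ∧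
        (fun n : ℕ => CondLD.condTail μ W Z n a ω) ~[atTop]
          fun n : ℕ => Real.exp (-(n : ℝ) * CondLD.rate f (fun j => W j ω) n a (ϑ n)) /
            (√(2 * Real.pi * n) * ϑ n * CondLD.sigma f (fun j => W j ω) n (ϑ n)) := by

  subst hf
  have hd1 := CondLD.hasDerivAt_cgf hmgf
  have hd2 := CondLD.hasDerivAt_deriv_cgf hmgf
  have hf'c := CondLD.continuous_deriv_cgf hmgf
  have hf0 := CondLD.iteratedDeriv_two_cgf_pos hmgf hZnondeg
  -- If the weights vanish, both endpoints of the interval are `0` and there is no `a` to consider.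
  by_cases hW0 : ∀ᵐ ω ∂μ, W 0 ω = 0
  · have h1 : ∫ ω', W 0 ω' ∂μ = 0 := integral_eq_zero_of_ae hW0
    have h2 : ∫ ω', W 0 ω' * deriv (cgf (Z 0) μ) (ϑs * W 0 ω') ∂μ = 0 :=
      integral_eq_zero_of_ae (hW0.mono fun ω hω => by simp [hω])
    simp [h1, h2]
  obtain ⟨F, hF, hFdom⟩ := hdom
  have hG := CondLD.integrable_varSup (CondLD.continuous_iteratedDeriv_two_cgf hmgf)
    (fun x => (hf0 x).le) hϑs.le (hWm 0) hF hFdom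
  have hreg := CondLD.ae_regularWeights hWm hWindep hWid hϑs.le hZnondeg hW0 hlattice hmgf hG
  -- Countably many parameters suffice: `m = 0` gives the right endpoint `ϑs`, and large `m`
  -- approaches the slope at `0`.
  have hconv : ∀ᵐ ω ∂μ, ∀ m : ℕ, Tendsto
      (fun n => deriv (CondLD.Psi (cgf (Z 0) μ) (fun j => W j ω) n) (ϑs / (m + 1))) atTop
      (nhds (∫ ω, W 0 ω * deriv (cgf (Z 0) μ) (ϑs / (m + 1) * W 0 ω) ∂μ)) :=
    ae_all_iff.2 fun m => CondLD.ae_tendsto_deriv_Psi hWindep hWid hd1 hf'c (hint' _)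
  have hmono : Monotone (deriv (cgf (Z 0) μ)) :=
    monotone_of_deriv_nonneg (fun x => (hd2 x).differentiableAt) fun x => by
      rw [(hd2 x).deriv]; exact (hf0 x).le
  have hzero : ∫ ω, W 0 ω * deriv (cgf (Z 0) μ) (0 * W 0 ω) ∂μ
      = (∫ ω', W 0 ω' ∂μ) * ∫ ω', Z 0 ω' ∂μ := by
    simp only [zero_mul]
    rw [integral_mul_const,
      deriv_cgf_zero (CondLD.mem_interior_integrableExpSet_of_forall hmgf 0)]
    simp
  have hseq : Tendsto (fun m : ℕ => ϑs / ((m : ℝ) + 1)) atTop (nhds 0) :=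
    tendsto_const_nhds.div_atTop (tendsto_natCast_atTop_atTop.atTop_add tendsto_const_nhds)
  have hseqmem : ∀ m : ℕ, ϑs / ((m : ℝ) + 1) ∈ Set.Icc 0 ϑs := fun m =>
    ⟨by positivity, div_le_self hϑs.le (by linarith [m.cast_nonneg (α := ℝ)])⟩
  have hlim0 := CondLD.tendsto_integral_mul_comp_mul hmono hf'c hint' hseqmem hseq
  rw [hzero] at hlim0
  filter_upwards [hreg, CondLD.ae_condTail_eq hWm hZm hWZ, hconv] with ω hw hct hcv a ha
  -- As `a` exceeds the limiting slope at `0`, some `ϑs / (m + 1)` has limiting slope below `a`; it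
  -- becomes the positive lower bound for the saddle points.
  obtain ⟨m, hm⟩ := (hlim0.eventually (gt_mem_nhds ha.1)).exists
  have hlo := (hcv m).eventually (gt_mem_nhds hm)
  have hhi := hcv 0
  simp only [Nat.cast_zero, zero_add, div_one] at hhi
  replace hhi := hhi.eventually (lt_mem_nhds ha.2)
  have hsm : ∀ᶠ n in atTop, StrictMono (deriv (CondLD.Psi (cgf (Z 0) μ) (fun j => W j ω) n)) :=
    hw.eventually_exists_ne_zero.mono fun n ⟨j, hj, hwj⟩ =>
      CondLD.strictMono_deriv_Psi hd1 hd2 hf0 hj hwj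
  refine ⟨?_, fun ϑ hϑ => ?_⟩
  · filter_upwards [hlo, hhi, hsm] with n h1 h2 h3
    have hc : Continuous (deriv (CondLD.Psi (cgf (Z 0) μ) (fun j => W j ω) n)) :=
      continuous_iff_continuousAt.2 fun θ => (CondLD.hasDerivAt_deriv_Psi hd1 hd2 n θ).continuousAt
    obtain ⟨θ, -, hθ⟩ := intermediate_value_Icc (hseqmem m).2 hc.continuousOn ⟨h1.le, h2.le⟩
    exact ⟨θ, hθ, fun θ' hθ' => h3.injective (hθ'.trans hθ.symm)⟩
  · simp_rw [hct]
    refine hw.isEquivalent_tail hZm hZindep hZid hmgf hZnondeg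
      (div_pos hϑs (by positivity : (0 : ℝ) < (m : ℝ) + 1)) ?_ hϑ
    filter_upwards [hlo, hhi, hsm, hϑ] with n h1 h2 h3 h4
    rw [← h4] at h1 h2
    exact ⟨(h3.lt_iff_lt.1 h1).le, (h3.lt_iff_lt.1 h2).le⟩
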